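/- Let $B=\begin{pmatrix}0&1\\-1&0\end{pmatrix}$. For complex-valued functions $p,q$ on $(0,\pi)$ with $(\pi-x)p(x),\,(\pi-x)q(x)\in L_2(0,\pi)$, let $D(p,q)$ be the boundary value problem $$By'(x)+\int_0^x M(x-t)y(t)\,dt=\lambda y(x),\quad 0<x<\pi,\qquad M=\begin{pmatrix}p&q\\-q&p\end{pmatrix},\quad y=\begin{pmatrix}y_1\\y_2\end{pmatrix},\qquad y_1(0)=y_1(\pi)=0,$$ where solutions are absolutely continuous on $[0,\pi]$ and satisfy the system almost everywhere. The multiplicity of an eigenvalue of $D(p,q)$ is its order as a zero of the characteristic function $\Delta(\lambda)=S_1(\pi,\lambda)$, where $S=(S_1,S_2)^T$ is the solution of the system with $S(0,\lambda)=(0,-1)^T$. Theorem. Let $\pi/2\le a<\pi$, $b:=\pi-a$, and let $p,q,\tilde p,\tilde q$ be functions of this class with $p=\tilde p$ and $q=\tilde q$ a.e. on $(0,a)$. Let the eigenvalues $\{\lambda_k\}_{k\in\mathbb Z}$ of $D(p,q)$ and $\{\tilde\lambda_k\}_{k\in\mathbb Z}$ of $D(\tilde p,\tilde q)$, listed with their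 multiplicities, be numbered so that $\sum_{k\in\mathbb Z}|\lambda_k-k|^2<\infty$ and $\sum_{k\in\mathbb Z}|\tilde\lambda_k-k|^2<\infty$. Let $\mathcal I\subset\mathbb Z$ be such that $\lambda_k=\tilde\lambda_k$ for all $k\in\mathcal I$. For $k\in\mathcal I$ let $m_k$ be the number of indices $i\in\mathcal I$ with $\lambda_i=\lambda_k$. Suppose that the system of vector functions of $t\in(0,b)$ $$S_{\mathcal I}=\left\{\begin{pmatrix}\frac{d^j}{d\lambda^j}\sin\lambda t\\[4pt]\frac{d^j}{d\lambda^j}\cos\lambda t\end{pmatrix}_{\lambda=\lambda_k}\;:\;k\in\mathcal I,\ j=0,\dots,m_k-1\right\}$$ is complete in $L_2(0,b)\oplus L_2(0,b)$ (its complex linear span is dense). Then $p=\tilde p$ and $q=\tilde q$ a.e. on $(a,\pi)$. -/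

import Mathlib

open MeasureTheory Set

noncomputable section

namespace IntegroDirac

/-- The class `L_{2,π}(0,π)`: functions `r` with `(π - x) r(x) ∈ L₂(0,π)`. -/
def MemL2Pi (r : ℝ → ℂ) : Prop :=
  MemLp (fun x : ℝ => ((Real.pi - x : ℝ) : ℂ) * r x) 2 (volume.restrict (Ioo 0 Real.pi))

/-- `y = (y₁, y₂)` is a solution on `(0,π)` of the integro-differential Dirac system
`B y' + ∫₀ˣ M(x - t) y(t) dt = z y`, with `B = [[0, 1], [-1, 0]]` and `M = [[p, q], [-q, p]]`:
both components are absolutely continuous on `[0,π]` and the system, which by components reads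
`y₂' + ∫₀ˣ (p(x-t) y₁(t) + q(x-t) y₂(t)) dt = z y₁`,
`-y₁' + ∫₀ˣ (-q(x-t) y₁(t) + p(x-t) y₂(t)) dt = z y₂`,
holds almost everywhere on `(0,π)`. -/
structure IsSolution (p q : ℝ → ℂ) (z : ℂ) (y₁ y₂ : ℝ → ℂ) : Prop where
  ac₁ : AbsolutelyContinuousOnInterval y₁ 0 Real.pi
  ac₂ : AbsolutelyContinuousOnInterval y₂ 0 Real.pi
  eq₁ : ∀ᵐ x ∂(volume.restrict (Ioo 0 Real.pi)),
    HasDerivAt y₂ (z * y₁ x - ∫ t in (0 : ℝ)..x, (p (x - t) * y₁ t + q (x - t) * y₂ t)) x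
  eq₂ : ∀ᵐ x ∂(volume.restrict (Ioo 0 Real.pi)),
    HasDerivAt y₁ ((∫ t in (0 : ℝ)..x, (-q (x - t) * y₁ t + p (x - t) * y₂ t)) - z * y₂ x) x

/-- `z` is an eigenvalue of the boundary value problem `D(p,q)`: there is a nontrivial solution
with `y₁(0) = y₁(π) = 0`. -/
def IsEigenvalue (p q : ℝ → ℂ) (z : ℂ) : Prop :=
  ∃ y₁ y₂ : ℝ → ℂ, IsSolution p q z y₁ y₂ ∧ y₁ 0 = 0 ∧ y₁ Real.pi = 0 ∧
    ∃ x ∈ Icc 0 Real.pi, y₁ x ≠ 0 ∨ y₂ x ≠ 0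

/-- `Δ` is the characteristic function of `D(p,q)`: `Δ(z) = S₁(π, z)`, where `S(·, z)` is the
solution with the initial values `S(0, z) = (0, -1)` (for `p = q = 0` this is `sin (z π)`). -/
def IsCharacteristicFunction (p q : ℝ → ℂ) (Δ : ℂ → ℂ) : Prop :=
  ∀ z : ℂ, ∃ S₁ S₂ : ℝ → ℂ, IsSolution p q z S₁ S₂ ∧ S₁ 0 = 0 ∧ S₂ 0 = -1 ∧ Δ z = S₁ Real.pi

/-- The family `lam` lists all the eigenvalues of `D(p,q)`, each one as many times as its
multiplicity, that is, its order as a zero of the characteristic function. -/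
structure IsEigenvalueNumbering (p q : ℝ → ℂ) (lam : ℤ → ℂ) : Prop where
  isEigenvalue_iff : ∀ z : ℂ, IsEigenvalue p q z ↔ ∃ k : ℤ, lam k = z
  multiplicity : ∃ Δ : ℂ → ℂ, IsCharacteristicFunction p q Δ ∧
    ∀ z : ℂ, {k : ℤ | lam k = z}.encard = analyticOrderAt Δ z

/-- `lam k = k + ϰ_k` with `{ϰ_k} ∈ l₂`. -/
def HasAsymptotics (lam : ℤ → ℂ) : Prop :=
  Summable fun k : ℤ => ‖lam k - (k : ℂ)‖ ^ 2

/-- Lebesgue space `L₂(0,b)` of complex functions. -/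
abbrev L2 (b : ℝ) : Type := Lp ℂ 2 (volume.restrict (Ioo 0 b))

/-- The Hilbert space `L₂(0,b) ⊕ L₂(0,b)`. -/
abbrev HilbertPair (b : ℝ) : Type := WithLp 2 (L2 b × L2 b)

/-- The multiplicity with which the value `lam k` occurs in the subfamily indexed by `I`. -/
def multIn (lam : ℤ → ℂ) (I : Set ℤ) (k : ℤ) : ℕ∞ :=
  {i : ℤ | i ∈ I ∧ lam i = lam k}.encard

/-- The system `S_I` of the vector functions
`t ↦ (dʲ/dzʲ sin (z t), dʲ/dzʲ cos (z t))` at `z = lam k`, for `k ∈ I` and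
`0 ≤ j < m_k`, as elements of `L₂(0,b) ⊕ L₂(0,b)`. -/
def systemS (b : ℝ) (lam : ℤ → ℂ) (I : Set ℤ) : Set (HilbertPair b) :=
  {f | ∃ k ∈ I, ∃ j : ℕ, (j : ℕ∞) < multIn lam I k ∧
    (f.fst =ᵐ[volume.restrict (Ioo 0 b)]
      fun t : ℝ => iteratedDeriv j (fun z : ℂ => Complex.sin (z * t)) (lam k)) ∧
    (f.snd =ᵐ[volume.restrict (Ioo 0 b)]
      fun t : ℝ => iteratedDeriv j (fun z : ℂ => Complex.cos (z * t)) (lam k))}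

/-- A system is complete when its linear span is dense. -/
def IsCompleteSystem {b : ℝ} (S : Set (HilbertPair b)) : Prop :=
  (Submodule.span ℂ S).topologicalClosure = ⊤

end IntegroDirac

end

/-! Since M = p + qB commutes with B, the combinations f = (y₁ - εy₂)/2 with ε = ±i diagonalise the
system into scalar equations f' = -εzf + r * f with r = ε(p + εq), and y₁ is the sum of the two
(`IsSolution.isScalarSolution`).

Let f, g solve f' = zf + r * f and g' = zg + r' * g with f(0) = g(0) = c. Integrating the derivative
of f(x)g(π - x) expresses c(f(π) - g(π)) as the integral of (r - r')(s)(f * g)(π - s)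
(`IsScalarSolution.lagrange_identity`). Only s > a contributes, so f * g is needed on (0,b) alone;
there b ≤ a makes both functions depend on the common part of r and r'.

On L₂(0,b) let e(t) = exp(zt), let E and C be convolution with e and r, and X multiplication by t.
Then f = g = c(1 - EC)⁻¹e, so f * g = c²(1 - EC)⁻²Ee = c² ∑ (n+1)CⁿEⁿ⁺¹e. As Eⁿe = Xⁿe/n!, this
equals c²XTe with T = ∑ AⁿXⁿ/n!, where XA = CX (`convOp_eq_transOp`). The operator T does not
involve z, and it is invertible (`isUnit_transOp`). The factor X = t compensates for the singularity
of r and r' at π.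

Moving T to the other factor by its adjoint gives f(π) - g(π) = c ∫ h(t)exp(zt) dt with h
independent of z, and h = 0 forces r = r' on (a,π) (`exists_representation`). Adding ε = ±i turns Δ
- Δ̃ into a sine-cosine transform of a pair (w₁, w₂) in L₂. The common eigenvalues are zeros of this
difference with the required multiplicities, so the pair is orthogonal, up to conjugation, to the
complete system and vanishes. -/

noncomputable section

namespace IntegroDirac

/-! ### Hilbert–Schmidt integral operators. -/

section HilbertSchmidt

variable {X : Type*} [MeasurableSpace X] {μ : Measure X}

lemma enorm_integral_mul_le {k g : X → ℂ} (hk : AEStronglyMeasurable k μ)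
    (hg : AEStronglyMeasurable g μ) :
    ‖∫ u, k u * g u ∂μ‖ₑ ≤ eLpNorm k 2 μ * eLpNorm g 2 μ := by
  refine (enorm_integral_le_lintegral_enorm _).trans ?_
  rw [← eLpNorm_one_eq_lintegral_enorm]
  have h : eLpNorm (k • g) 1 μ ≤ eLpNorm k 2 μ * eLpNorm g 2 μ :=
    eLpNorm_smul_le_mul_eLpNorm hg hk
  exact h

lemma eLpNorm_two_sq (f : X → ℂ) : eLpNorm f 2 μ ^ (2 : ℝ) = ∫⁻ x, ‖f x‖ₑ ^ (2 : ℝ) ∂μ := by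
  simpa using eLpNorm_nnreal_pow_eq_lintegral (f := f) (μ := μ) (p := 2) (by norm_num)

/-- Cauchy–Schwarz in u for almost every fixed s, then Tonelli in s. -/
lemma eLpNorm_integral_mul_le [SFinite μ] {K : X × X → ℂ}
    (hK : AEStronglyMeasurable K (μ.prod μ)) {g : X → ℂ} (hg : AEStronglyMeasurable g μ) :
    eLpNorm (fun s => ∫ u, K (s, u) * g u ∂μ) 2 μ ≤ eLpNorm K 2 (μ.prod μ) * eLpNorm g 2 μ := by
  rw [← ENNReal.rpow_le_rpow_iff (z := 2) (by norm_num), eLpNorm_two_sq,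
    ENNReal.mul_rpow_of_nonneg _ _ (by norm_num), eLpNorm_two_sq K,
    lintegral_prod _ (hK.enorm.pow_const _)]
  have h : ∀ᵐ s ∂μ, ‖∫ u, K (s, u) * g u ∂μ‖ₑ ^ (2 : ℝ) ≤
      (∫⁻ u, ‖K (s, u)‖ₑ ^ (2 : ℝ) ∂μ) * eLpNorm g 2 μ ^ (2 : ℝ) := by
    filter_upwards [hK.prodMk_left] with s hs
    rw [← eLpNorm_two_sq, ← ENNReal.mul_rpow_of_nonneg _ _ (by norm_num)]
    exact ENNReal.rpow_le_rpow (enorm_integral_mul_le hs hg) (by norm_num)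
  refine (lintegral_mono_ae h).trans (lintegral_mul_const'' _ ?_).le
  exact (hK.enorm.pow_const _).lintegral_prod_right'

lemma memLp_integral_mul [SFinite μ] {K : X × X → ℂ} (hK : MemLp K 2 (μ.prod μ)) {g : X → ℂ}
    (hg : MemLp g 2 μ) : MemLp (fun s => ∫ u, K (s, u) * g u ∂μ) 2 μ := by
  refine ⟨?_, (eLpNorm_integral_mul_le hK.1 hg.1).trans_lt (ENNReal.mul_lt_top hK.2 hg.2)⟩
  exact (hK.1.mul hg.1.comp_snd).integral_prod_right' (f := fun z => K z * g z.2)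

lemma ae_integrable_mul [SFinite μ] {K : X × X → ℂ} (hK : MemLp K 2 (μ.prod μ)) :
    ∀ᵐ s ∂μ, ∀ g : X → ℂ, MemLp g 2 μ → Integrable (fun u => K (s, u) * g u) μ := by
  have h1 : Integrable (fun z => ‖K z‖ ^ (2 : ℝ)) (μ.prod μ) := by
    simpa using hK.integrable_norm_rpow (by norm_num) (by norm_num)
  filter_upwards [h1.prod_right_ae, hK.1.prodMk_left] with s hs hs' g hg
  have : MemLp (fun u => K (s, u)) 2 μ := by
    rw [← integrable_norm_rpow_iff hs' (by norm_num) (by norm_num)]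
    simpa using hs
  exact this.integrable_mul hg

open Classical in
/-- The Hilbert–Schmidt operator on `L₂(μ)` with the kernel `K`. -/
def hilbertSchmidt (μ : Measure X) [SFinite μ] (K : X × X → ℂ) : Lp ℂ 2 μ →L[ℂ] Lp ℂ 2 μ :=
  if hK : MemLp K 2 (μ.prod μ) then
    LinearMap.mkContinuous
      { toFun := fun g => (memLp_integral_mul hK (Lp.memLp g)).toLp
        map_add' := fun g g' => by
          rw [← MemLp.toLp_add]
          apply MemLp.toLp_congr
          filter_upwards [ae_integrable_mul hK] with s hs
          rw [Pi.add_apply, ← integral_add (hs _ (Lp.memLp g)) (hs _ (Lp.memLp g'))]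
          apply integral_congr_ae
          filter_upwards [Lp.coeFn_add g g'] with u hu
          simp only [hu, Pi.add_apply, mul_add]
        map_smul' := fun c g => by
          rw [RingHom.id_apply, ← MemLp.toLp_const_smul]
          apply MemLp.toLp_congr
          refine Filter.Eventually.of_forall fun s => ?_
          rw [Pi.smul_apply, smul_eq_mul, ← integral_const_mul]
          apply integral_congr_ae
          filter_upwards [Lp.coeFn_smul c g] with u hu
          simp only [hu, Pi.smul_apply, smul_eq_mul]
          ring }
      (eLpNorm K 2 (μ.prod μ)).toReal
      fun g => by
        simp only [LinearMap.coe_mk, AddHom.coe_mk, Lp.norm_toLp]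
        rw [Lp.norm_def, ← ENNReal.toReal_mul]
        exact ENNReal.toReal_mono (ENNReal.mul_ne_top hK.2.ne (Lp.memLp g).2.ne)
          (eLpNorm_integral_mul_le hK.1 (Lp.memLp g).1)
  else 0

variable [SFinite μ] {K : X × X → ℂ}

lemma coeFn_hilbertSchmidt (hK : MemLp K 2 (μ.prod μ)) (g : Lp ℂ 2 μ) :
    hilbertSchmidt μ K g =ᵐ[μ] fun s => ∫ u, K (s, u) * g u ∂μ := by
  rw [hilbertSchmidt, dif_pos hK]
  exact MemLp.coeFn_toLp (memLp_integral_mul hK (Lp.memLp g))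

lemma norm_hilbertSchmidt_le (hK : MemLp K 2 (μ.prod μ)) :
    ‖hilbertSchmidt μ K‖ ≤ (eLpNorm K 2 (μ.prod μ)).toReal := by
  rw [hilbertSchmidt, dif_pos hK]
  exact LinearMap.mkContinuous_norm_le _ ENNReal.toReal_nonneg _

end HilbertSchmidt

/-! ### Multiplication operators. -/

section Multiplication

variable {X : Type*} [MeasurableSpace X] {μ : Measure X}

open Classical in
/-- The operator of multiplication by an essentially bounded function `m` on `L₂(μ)`. -/
def mulOp (μ : Measure X) (m : X → ℂ) : Lp ℂ 2 μ →L[ℂ] Lp ℂ 2 μ :=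
  if hm : MemLp m ⊤ μ then (ContinuousLinearMap.mul ℂ ℂ).holderL μ ⊤ 2 2 hm.toLp else 0

lemma coeFn_mulOp {m : X → ℂ} (hm : MemLp m ⊤ μ) (g : Lp ℂ 2 μ) :
    mulOp μ m g =ᵐ[μ] fun x => m x * g x := by
  rw [mulOp, dif_pos hm]
  filter_upwards [ContinuousLinearMap.coeFn_holder (r := 2) (ContinuousLinearMap.mul ℂ ℂ)
    (hm.toLp) g, hm.coeFn_toLp] with x h1 h2
  refine Eq.trans h1 ?_
  simp [h2]

lemma norm_mulOp_le {m : X → ℂ} (hm : MemLp m ⊤ μ) {C : ℝ} (hC : 0 ≤ C)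
    (h : ∀ᵐ x ∂μ, ‖m x‖ ≤ C) : ‖mulOp μ m‖ ≤ C := by
  refine ContinuousLinearMap.opNorm_le_bound _ hC fun g => ?_
  apply Lp.norm_le_mul_norm_of_ae_le_mul
  filter_upwards [coeFn_mulOp hm g, h] with x h1 h2
  rw [h1, norm_mul]
  gcongr

end Multiplication

/-! ### Convolution operators on (0,b) and their commutation. -/

section Convolution

/-- The convolution of the restrictions of `k` and `g` to `(0,b)`. -/
def conv (b : ℝ) (k g : ℝ → ℂ) (x : ℝ) : ℂ :=
  ∫ t, (Ioo 0 b).indicator k (x - t) * (Ioo 0 b).indicator g t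

/-- The kernel of the convolution operator on `(0,b)`. -/
def convKernel (b : ℝ) (k : ℝ → ℂ) (z : ℝ × ℝ) : ℂ := (Ioo 0 b).indicator k (z.1 - z.2)

/-- The operator of convolution with `k` on `L₂(0,b)`. -/
def convOp (b : ℝ) (k : ℝ → ℂ) : L2 b →L[ℂ] L2 b :=
  hilbertSchmidt (volume.restrict (Ioo 0 b)) (convKernel b k)

variable {b : ℝ} {k l g : ℝ → ℂ}

/-- The two indicators confine t to (0,x). Keeping them and integrating over the whole line lets
later substitutions proceed without moving limits. -/
lemma conv_eq_intervalIntegral {x : ℝ} (hx : x ∈ Ioc 0 b) :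
    conv b k g x = ∫ t in (0 : ℝ)..x, k (x - t) * g t := by
  rw [intervalIntegral.integral_of_le hx.1.le, integral_Ioc_eq_integral_Ioo,
    ← integral_indicator measurableSet_Ioo, conv]
  congr 1
  ext t
  by_cases ht : t ∈ Ioo 0 x
  · have h1 : x - t ∈ Ioo 0 b := ⟨by linarith [ht.2], by linarith [ht.1, hx.2]⟩
    have h2 : t ∈ Ioo 0 b := ⟨ht.1, ht.2.trans_le hx.2⟩
    simp [indicator_of_mem, ht, h1, h2]
  · rw [indicator_of_notMem ht]
    by_cases h1 : x - t ∈ Ioo 0 b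
    · rw [indicator_of_notMem (s := Ioo 0 b) (a := t), mul_zero]
      exact fun h2 => ht ⟨h2.1, by linarith [h1.1]⟩
    · rw [indicator_of_notMem h1, zero_mul]

lemma conv_comm (x : ℝ) : conv b k g x = conv b g k x := by
  rw [conv, conv, ← integral_sub_left_eq_self _ volume x]
  simp only [sub_sub_cancel, mul_comm]

lemma indicator_ae_eq {k k' : ℝ → ℂ} (h : k =ᵐ[volume.restrict (Ioo 0 b)] k') :
    (Ioo 0 b).indicator k =ᵐ[volume] (Ioo 0 b).indicator k' := by
  rw [Filter.EventuallyEq, ae_restrict_iff' measurableSet_Ioo] at h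
  filter_upwards [h] with x hx
  by_cases hxb : x ∈ Ioo 0 b
  · simp [hxb, hx hxb]
  · simp [hxb]

lemma conv_congr {k' g' : ℝ → ℂ} (hk : k =ᵐ[volume.restrict (Ioo 0 b)] k')
    (hg : g =ᵐ[volume.restrict (Ioo 0 b)] g') (x : ℝ) : conv b k g x = conv b k' g' x := by
  apply integral_congr_ae
  filter_upwards [(quasiMeasurePreserving_sub_left volume x).ae (indicator_ae_eq hk),
    indicator_ae_eq hg] with t h1 h2
  rw [h1, h2]

lemma memLp_indicator {p : ENNReal} (hk : MemLp k p (volume.restrict (Ioo 0 b))) :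
    MemLp ((Ioo 0 b).indicator k) p volume :=
  (memLp_indicator_iff_restrict measurableSet_Ioo).2 hk

lemma aestronglyMeasurable_convKernel (hk : MemLp k 2 (volume.restrict (Ioo 0 b))) :
    AEStronglyMeasurable (convKernel b k)
      ((volume.restrict (Ioo 0 b)).prod (volume.restrict (Ioo 0 b))) := by
  rw [Measure.prod_restrict]
  exact ((memLp_indicator hk).1.comp_quasiMeasurePreserving
    (quasiMeasurePreserving_sub volume volume)).restrict

/-- By translation invariance each slice has norm at most that of k; integrating the squares over s
contributes the factor b. -/
lemma eLpNorm_convKernel_le (hk : MemLp k 2 (volume.restrict (Ioo 0 b))) :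
    eLpNorm (convKernel b k) 2
      ((volume.restrict (Ioo 0 b)).prod (volume.restrict (Ioo 0 b))) ≤
      ENNReal.ofReal b ^ (2⁻¹ : ℝ) * eLpNorm k 2 (volume.restrict (Ioo 0 b)) := by
  rw [← ENNReal.rpow_le_rpow_iff (z := 2) (by norm_num), eLpNorm_two_sq,
    ENNReal.mul_rpow_of_nonneg _ _ (by norm_num), ← ENNReal.rpow_mul,
    inv_mul_cancel₀ (by norm_num), ENNReal.rpow_one,
    lintegral_prod _ ((aestronglyMeasurable_convKernel hk).enorm.pow_const _)]
  have h : ∀ s : ℝ, ∫⁻ u in Ioo 0 b, ‖convKernel b k (s, u)‖ₑ ^ (2 : ℝ) ≤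
      eLpNorm k 2 (volume.restrict (Ioo 0 b)) ^ (2 : ℝ) := fun s => by
    rw [← eLpNorm_indicator_eq_eLpNorm_restrict measurableSet_Ioo, eLpNorm_two_sq]
    refine (setLIntegral_le_lintegral _ _).trans_eq ?_
    exact lintegral_sub_left_eq_self (fun u => ‖(Ioo 0 b).indicator k u‖ₑ ^ (2 : ℝ)) s
  refine (lintegral_mono fun s => h s).trans ?_
  rw [lintegral_const, mul_comm]
  simp

lemma memLp_convKernel (hk : MemLp k 2 (volume.restrict (Ioo 0 b))) :
    MemLp (convKernel b k) 2 ((volume.restrict (Ioo 0 b)).prod (volume.restrict (Ioo 0 b))) :=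
  ⟨aestronglyMeasurable_convKernel hk, (eLpNorm_convKernel_le hk).trans_lt
    (ENNReal.mul_lt_top (ENNReal.rpow_lt_top_of_nonneg (by norm_num) ENNReal.ofReal_ne_top) hk.2)⟩

lemma coeFn_convOp (hk : MemLp k 2 (volume.restrict (Ioo 0 b))) (g : L2 b) :
    convOp b k g =ᵐ[volume.restrict (Ioo 0 b)] conv b k g := by
  refine (coeFn_hilbertSchmidt (memLp_convKernel hk) g).trans
    (Filter.Eventually.of_forall fun s => ?_)
  simp only [conv, convKernel]
  rw [← integral_indicator measurableSet_Ioo]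
  congr 1
  ext u
  by_cases hu : u ∈ Ioo 0 b
  · simp [hu]
  · simp [hu]

lemma norm_convOp_le (hb : 0 ≤ b) (k : L2 b) : ‖convOp b k‖ ≤ Real.sqrt b * ‖k‖ := by
  refine (norm_hilbertSchmidt_le (memLp_convKernel (Lp.memLp k))).trans ?_
  refine (ENNReal.toReal_mono ?_ (eLpNorm_convKernel_le (Lp.memLp k))).trans_eq ?_
  · exact ENNReal.mul_ne_top (ENNReal.rpow_ne_top_of_nonneg (by norm_num) ENNReal.ofReal_ne_top)
      (Lp.memLp k).2.ne
  · rw [ENNReal.toReal_mul, Lp.norm_def, ← ENNReal.toReal_rpow, Real.sqrt_eq_rpow, one_div]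
    rw [ENNReal.toReal_ofReal hb]

/-- For fixed s, Cauchy–Schwarz in t bounds the inner integral by ‖K‖‖L‖|G(s)|, which is integrable.
This licenses Fubini for iterated convolutions. -/
lemma integrable_convolution_triple {K L G : ℝ → ℂ} (hK : MemLp K 2 volume)
    (hL : MemLp L 2 volume) (hG : Integrable G) (x : ℝ) :
    Integrable (fun z : ℝ × ℝ => K (x - z.1) * L (z.1 - z.2) * G z.2) (volume.prod volume) := by
  have hKx : MemLp (fun t => K (x - t)) 2 volume :=
    hK.comp_measurePreserving (Measure.measurePreserving_sub_left volume x)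
  have hLs : ∀ s, MemLp (fun t => L (t - s)) 2 volume := fun s =>
    hL.comp_measurePreserving (measurePreserving_sub_right volume s)
  have hm : AEStronglyMeasurable (fun z : ℝ × ℝ => K (x - z.1) * L (z.1 - z.2) * G z.2)
      (volume.prod volume) :=
    (hKx.1.comp_fst.mul (hL.1.comp_quasiMeasurePreserving
      (quasiMeasurePreserving_sub volume volume))).mul hG.1.comp_snd
  rw [integrable_prod_iff' hm]
  refine ⟨Filter.Eventually.of_forall fun s => ?_, ?_⟩
  · exact (hKx.integrable_mul (hLs s)).mul_const (G s)
  refine (hG.norm.const_mul (eLpNorm K 2 volume * eLpNorm L 2 volume).toReal).mono'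
    hm.prod_swap.norm.integral_prod_right' (Filter.Eventually.of_forall fun s => ?_)
  have h1 : ∫ t, ‖K (x - t) * L (t - s) * G s‖ = (∫ t, ‖K (x - t) * L (t - s)‖) * ‖G s‖ := by
    simp only [norm_mul, integral_mul_const]
  simp only at h1 ⊢
  rw [h1, Real.norm_of_nonneg (by positivity)]
  gcongr
  refine (integral_norm_eq_lintegral_enorm (hKx.1.mul (hLs s).1)).trans_le ?_
  rw [← eLpNorm_one_eq_lintegral_enorm]
  refine ENNReal.toReal_mono (ENNReal.mul_ne_top hK.2.ne hL.2.ne) ?_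
  have h : eLpNorm ((fun t => K (x - t)) • (fun t => L (t - s))) 1 volume ≤
    eLpNorm (fun t => K (x - t)) 2 volume * eLpNorm (fun t => L (t - s)) 2 volume :=
    eLpNorm_smul_le_mul_eLpNorm (hLs s).1 hKx.1
  refine h.trans_eq ?_
  congr 1
  · exact eLpNorm_comp_measurePreserving hK.1 (Measure.measurePreserving_sub_left volume x)
  · exact eLpNorm_comp_measurePreserving hL.1 (measurePreserving_sub_right volume s)

/-- The cutoff on the inner convolution is redundant: the outer kernel forces t < x ≤ b, and for t ≤
0 the inner integrand is already zero. -/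
lemma conv_conv_eq_integral {x : ℝ} (hx : x ≤ b) :
    conv b k (conv b l g) x = ∫ t, ∫ s, (Ioo 0 b).indicator k (x - t) *
      (Ioo 0 b).indicator l (t - s) * (Ioo 0 b).indicator g s := by
  rw [conv]
  congr 1
  ext t
  simp only [mul_assoc]
  rw [integral_const_mul]
  by_cases h1 : x - t ∈ Ioo 0 b
  · congr 1
    by_cases h2 : t ∈ Ioo 0 b
    · rw [indicator_of_mem h2, conv]
    · rw [indicator_of_notMem h2]
      have h3 : t ≤ 0 := by
        by_contra! h3
        exact h2 ⟨h3, by linarith [h1.1]⟩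
      symm
      apply integral_eq_zero_of_ae
      refine Filter.Eventually.of_forall fun s => ?_
      by_cases hs : s ∈ Ioo 0 b
      · have : t - s ∉ Ioo 0 b := fun h => by linarith [h.1, hs.1]
        simp [indicator_of_notMem this]
      · simp [indicator_of_notMem hs]
  · simp [indicator_of_notMem h1]

lemma integrable_of_memLp_two (hg : MemLp g 2 (volume.restrict (Ioo 0 b))) :
    Integrable ((Ioo 0 b).indicator g) :=
  (integrable_indicator_iff measurableSet_Ioo).2
    (memLp_one_iff_integrable.1 (hg.mono_exponent (by norm_num)))

lemma conv_left_comm (hk : MemLp k 2 (volume.restrict (Ioo 0 b)))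
    (hl : MemLp l 2 (volume.restrict (Ioo 0 b))) (hg : MemLp g 2 (volume.restrict (Ioo 0 b)))
    {x : ℝ} (hx : x ≤ b) : conv b k (conv b l g) x = conv b l (conv b k g) x := by
  have h1 := integrable_convolution_triple (memLp_indicator hk) (memLp_indicator hl)
    (integrable_of_memLp_two hg) x
  have h2 := integrable_convolution_triple (memLp_indicator hl) (memLp_indicator hk)
    (integrable_of_memLp_two hg) x
  rw [conv_conv_eq_integral hx, conv_conv_eq_integral hx]
  refine (integral_integral_swap h1).trans (Eq.trans ?_ (integral_integral_swap h2).symm)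
  congr 1
  ext s
  -- The reflection t ↦ x + s - t exchanges the arguments x - t and t - s, hence the roles of the
  -- two kernels.
  rw [← integral_sub_left_eq_self _ volume (x + s)]
  congr 1
  ext t
  rw [show x - (x + s - t) = t - s by ring, show x + s - t - s = x - t by ring]
  ring

lemma convOp_commute (hk : MemLp k 2 (volume.restrict (Ioo 0 b)))
    (hl : MemLp l 2 (volume.restrict (Ioo 0 b))) : Commute (convOp b k) (convOp b l) := by
  have h : ∀ g : L2 b, convOp b k (convOp b l g) = convOp b l (convOp b k g) := fun g => by
    apply Lp.ext
    filter_upwards [coeFn_convOp hk (convOp b l g), coeFn_convOp hl (convOp b k g),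
      ae_restrict_mem measurableSet_Ioo] with x h1 h2 hx
    rw [h1, h2, conv_congr (Filter.EventuallyEq.refl _ _) (coeFn_convOp hl g),
      conv_congr (Filter.EventuallyEq.refl _ _) (coeFn_convOp hk g),
      conv_left_comm hk hl (Lp.memLp g) hx.2.le]
  exact ContinuousLinearMap.ext h

lemma convOp_comm (k g : L2 b) : convOp b k g = convOp b g k := by
  apply Lp.ext
  filter_upwards [coeFn_convOp (Lp.memLp k) g, coeFn_convOp (Lp.memLp g) k] with x h1 h2
  rw [h1, h2, conv_comm]

lemma convOp_congr {k' : ℝ → ℂ} (hk : MemLp k 2 (volume.restrict (Ioo 0 b)))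
    (h : k =ᵐ[volume.restrict (Ioo 0 b)] k') : convOp b k = convOp b k' := by
  refine ContinuousLinearMap.ext fun g => Lp.ext ?_
  filter_upwards [coeFn_convOp hk g, coeFn_convOp (hk.ae_eq h) g] with x h1 h2
  rw [h1, h2, conv_congr h (Filter.EventuallyEq.refl _ _)]

end Convolution

/-! ### Invertibility of an exponential-type series in two noncommuting elements. -/

section ExpSeries

open Nat

variable {𝔸 : Type*} [NormedRing 𝔸] [NormedAlgebra ℂ 𝔸]

/-- The sum of the series `∑ Aⁿ Xⁿ / n!`. -/
def expSeries (A X : 𝔸) : 𝔸 := ∑' n : ℕ, ((n ! : ℂ)⁻¹) • (A ^ n * X ^ n)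

/-- The index 0 is excluded because ‖1‖ = 1 is not assumed in the ring. -/
lemma norm_expSeries_term_le (A X : 𝔸) {n : ℕ} (hn : 0 < n) :
    ‖((n ! : ℂ)⁻¹) • (A ^ n * X ^ n)‖ ≤ (‖A‖ * ‖X‖) ^ n / n ! := by
  rw [norm_smul, norm_inv, RCLike.norm_natCast, mul_pow, inv_mul_eq_div]
  gcongr
  refine (norm_mul_le _ _).trans ?_
  gcongr <;> exact norm_pow_le' _ hn

variable [CompleteSpace 𝔸]

lemma hasSum_expSeries (A X : 𝔸) :
    HasSum (fun n : ℕ => ((n ! : ℂ)⁻¹) • (A ^ n * X ^ n)) (expSeries A X) :=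
  ((summable_nat_add_iff 1).1 (Summable.of_norm_bounded
    ((summable_nat_add_iff 1).2 (Real.summable_pow_div_factorial (‖A‖ * ‖X‖)))
    fun n => norm_expSeries_term_le A X n.succ_pos)).hasSum

/-- The terms with n ≥ 1 sum to norm at most x/(1 - x) < 1 for x = ‖A‖‖X‖ < 1/2, so the sum is a
perturbation of 1 by less than 1. -/
lemma isUnit_expSeries_of_small {A X : 𝔸} (h : ‖A‖ * ‖X‖ < 1 / 2) :
    IsUnit (expSeries A X) := by
  set x := ‖A‖ * ‖X‖
  have hx : 0 ≤ x := by positivity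
  have h1 := (hasSum_nat_add_iff' 1).2 (hasSum_expSeries A X)
  simp only [Finset.range_one, Finset.sum_singleton, factorial_zero, Nat.cast_one, inv_one,
    pow_zero, mul_one, one_smul] at h1
  have h2 : HasSum (fun n : ℕ => x * x ^ n) (x * (1 - x)⁻¹) :=
    (hasSum_geometric_of_lt_one hx (by linarith)).mul_left x
  have h3 : ‖expSeries A X - 1‖ ≤ x * (1 - x)⁻¹ := by
    rw [← h1.tsum_eq]
    refine tsum_of_norm_bounded h2 fun n => (norm_expSeries_term_le A X n.succ_pos).trans ?_
    change x ^ (n + 1) / _ ≤ _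
    rw [← _root_.pow_succ']
    exact div_le_self (by positivity) (by exact_mod_cast (n + 1).factorial_pos)
  have h4 : x * (1 - x)⁻¹ < 1 := by
    rw [← div_eq_mul_inv, div_lt_one (by linarith)]
    linarith
  have h5 : ‖1 - expSeries A X‖ < 1 := by
    rw [norm_sub_rev]
    linarith
  have h6 := (Units.oneSub _ h5).isUnit
  simpa using h6

lemma isUnit_expSeries_of_conj {A A' X : 𝔸} (W : 𝔸ˣ) (hA : (W : 𝔸) * A' = A * W)
    (hX : (W : 𝔸) * X = X * W) (h : IsUnit (expSeries A' X)) : IsUnit (expSeries A X) := by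
  have h1 := (hasSum_expSeries A' X).mul_left (W : 𝔸)
  have h2 := (hasSum_expSeries A X).mul_right (W : 𝔸)
  have h3 : (W : 𝔸) * expSeries A' X = expSeries A X * W := by
    refine h1.unique (h2.congr_fun ?_)
    intro n
    have hA' : SemiconjBy (W : 𝔸) A' A := hA
    have hX' : SemiconjBy (W : 𝔸) X X := hX
    have := ((hA'.pow_right n).mul_right (hX'.pow_right n)).eq
    rw [mul_smul_comm, this, smul_mul_assoc]
  have h4 : IsUnit (expSeries A X * W) := h3 ▸ (W.isUnit.mul h)
  exact (Units.isUnit_mul_units _ W).1 h4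

end ExpSeries

/-! ### The transformation operator and the convolution of two solutions. -/

section Operators

variable {b : ℝ} {r : ℝ → ℂ}

lemma memLp_of_continuousOn {m : ℝ → ℂ} (hm : ContinuousOn m (Icc 0 b)) (p : ENNReal) :
    MemLp m p (volume.restrict (Ioo 0 b)) := by
  obtain ⟨C, hC⟩ := isCompact_Icc.exists_bound_of_continuousOn hm
  refine MemLp.of_bound ((hm.mono Ioo_subset_Icc_self).aestronglyMeasurable measurableSet_Ioo) C ?_
  filter_upwards [ae_restrict_mem measurableSet_Ioo] with x hx
  exact hC x (Ioo_subset_Icc_self hx)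

/-- The operator of multiplication by the variable on `L₂(0,b)`. -/
def coordOp (b : ℝ) : L2 b →L[ℂ] L2 b := mulOp (volume.restrict (Ioo 0 b)) fun t => (t : ℂ)

lemma coeFn_coordOp (g : L2 b) :
    coordOp b g =ᵐ[volume.restrict (Ioo 0 b)] fun t => (t : ℂ) * g t :=
  coeFn_mulOp (memLp_of_continuousOn (by fun_prop) _) g

lemma coeFn_coordOp_pow (n : ℕ) (g : L2 b) :
    (coordOp b ^ n) g =ᵐ[volume.restrict (Ioo 0 b)] fun t => (t : ℂ) ^ n * g t := by
  induction n with
  | zero => exact Filter.Eventually.of_forall fun t => by simp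
  | succ n ih =>
    rw [pow_succ']
    filter_upwards [coeFn_coordOp ((coordOp b ^ n) g), ih] with t h1 h2
    refine Eq.trans h1 ?_
    rw [h2]
    ring

/-- The exponential function `t ↦ exp (z t)`. -/
def expFun (z : ℂ) (t : ℝ) : ℂ := Complex.exp (z * t)

lemma continuous_expFun (z : ℂ) : Continuous (expFun z) := by
  unfold expFun
  fun_prop

lemma memLp_expFun (z : ℂ) (p : ENNReal) : MemLp (expFun z) p (volume.restrict (Ioo 0 b)) :=
  memLp_of_continuousOn (continuous_expFun z).continuousOn p

lemma expFun_sub (z : ℂ) (x t : ℝ) : expFun z (x - t) * expFun z t = expFun z x := by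
  simp only [expFun, ← Complex.exp_add]
  congr 1
  push_cast
  ring

/-- The exponential function `t ↦ exp (z t)` as an element of `L₂(0,b)`. -/
def expL (b : ℝ) (z : ℂ) : L2 b := (memLp_expFun z 2).toLp

lemma coeFn_expL (z : ℂ) : expL b z =ᵐ[volume.restrict (Ioo 0 b)] expFun z :=
  MemLp.coeFn_toLp _

/-- The exponentials combine to exp(zx), independent of t, leaving the integral of tⁿ over (0,x). -/
lemma convOp_expFun_pow_expL (z : ℂ) (n : ℕ) :
    convOp b (expFun z) ((coordOp b ^ n) (expL b z)) =
      ((n + 1 : ℂ)⁻¹) • (coordOp b ^ (n + 1)) (expL b z) := by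
  apply Lp.ext
  filter_upwards [coeFn_convOp (memLp_expFun z 2) ((coordOp b ^ n) (expL b z)),
    Lp.coeFn_smul ((n + 1 : ℂ)⁻¹) ((coordOp b ^ (n + 1)) (expL b z)),
    coeFn_coordOp_pow (n + 1) (expL b z), coeFn_expL z, ae_restrict_mem measurableSet_Ioo]
    with x h1 h2 h3 h4 hx
  rw [h1, h2, Pi.smul_apply, h3, h4, smul_eq_mul,
    conv_congr (g' := fun t : ℝ => (t : ℂ) ^ n * expFun z t) (Filter.EventuallyEq.refl _ _)
      ((coeFn_coordOp_pow n (expL b z)).trans ?_),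
    conv_eq_intervalIntegral (Ioo_subset_Ioc_self hx)]
  · have h : ∀ t : ℝ, expFun z (x - t) * ((t : ℂ) ^ n * expFun z t) =
        ((t ^ n : ℝ) : ℂ) * expFun z x := fun t => by
      rw [← expFun_sub z x t]
      push_cast
      ring
    simp only [h]
    rw [intervalIntegral.integral_mul_const, intervalIntegral.integral_ofReal, integral_pow]
    push_cast
    field_simp
    simp
  · filter_upwards [coeFn_expL z] with t ht
    rw [ht]

lemma convOp_pow_expL (z : ℂ) (n : ℕ) :
    (convOp b (expFun z) ^ n) (expL b z) = ((n.factorial : ℂ)⁻¹) • (coordOp b ^ n) (expL b z) := by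
  induction n with
  | zero => simp
  | succ n ih =>
    rw [pow_succ', mul_apply_eq_comp, ih, map_smul, convOp_expFun_pow_expL, smul_smul,
      Nat.factorial_succ]
    push_cast
    rw [mul_inv, mul_comm]

/-- The kernel `(u / s) exp (-(s - u) w) r (s - u)` on `0 < u < s < b`. -/
def ratioKernel (b : ℝ) (r : ℝ → ℂ) (w : ℝ) (z : ℝ × ℝ) : ℂ :=
  ((z.2 / z.1 * Real.exp (-(w * (z.1 - z.2))) : ℝ) : ℂ) * convKernel b r z

/-- The integral operator on `L₂(0,b)` with the kernel `ratioKernel`. -/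
def ratioOp (b : ℝ) (r : ℝ → ℂ) (w : ℝ) : L2 b →L[ℂ] L2 b :=
  hilbertSchmidt (volume.restrict (Ioo 0 b)) (ratioKernel b r w)

/-- The kernel lives on u < s, where both u/s and the damping factor are at most 1; thus the factor
1/s does no harm. -/
lemma norm_ratioKernel_le {w : ℝ} (hw : 0 ≤ w) {z : ℝ × ℝ} (hz : z ∈ Ioo 0 b ×ˢ Ioo 0 b) :
    ‖ratioKernel b r w z‖ ≤ ‖convKernel b r z‖ := by
  rw [ratioKernel, norm_mul]
  by_cases h : z.1 - z.2 ∈ Ioo 0 b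
  · refine mul_le_of_le_one_left (norm_nonneg _) ?_
    have h1 := hz.1.1
    have h2 := hz.2.1
    rw [Complex.norm_real, Real.norm_of_nonneg (by positivity)]
    refine mul_le_one₀ ?_ (by positivity) ?_
    · rw [div_le_one h1]
      linarith [h.1]
    · rw [Real.exp_le_one_iff]
      have := mul_nonneg hw h.1.le
      linarith
  · simp [convKernel, indicator_of_notMem h]

lemma ae_mem_square : ∀ᵐ z ∂((volume.restrict (Ioo 0 b)).prod (volume.restrict (Ioo 0 b))),
    z ∈ Ioo (0 : ℝ) b ×ˢ Ioo 0 b := by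
  rw [Measure.prod_restrict]
  exact ae_restrict_mem (measurableSet_Ioo.prod measurableSet_Ioo)

lemma memLp_ratioKernel (hr : MemLp r 2 (volume.restrict (Ioo 0 b))) {w : ℝ} (hw : 0 ≤ w) :
    MemLp (ratioKernel b r w) 2
      ((volume.restrict (Ioo 0 b)).prod (volume.restrict (Ioo 0 b))) := by
  refine (memLp_convKernel hr).of_le ?_ ?_
  · refine AEStronglyMeasurable.mul (Measurable.aestronglyMeasurable ?_)
      (aestronglyMeasurable_convKernel hr)
    fun_prop
  · filter_upwards [ae_mem_square] with z hz
    exact norm_ratioKernel_le hw hz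

/-- This makes `ratioOp b r 0` a bounded substitute for X⁻¹CX, with no inverse of X required. -/
lemma coordOp_mul_ratioOp (hr : MemLp r 2 (volume.restrict (Ioo 0 b))) :
    coordOp b * ratioOp b r 0 = convOp b r * coordOp b := by
  refine ContinuousLinearMap.ext fun g => Lp.ext ?_
  rw [mul_apply_eq_comp, mul_apply_eq_comp]
  filter_upwards [coeFn_coordOp (ratioOp b r 0 g),
    coeFn_hilbertSchmidt (memLp_ratioKernel hr le_rfl) g,
    coeFn_hilbertSchmidt (memLp_convKernel hr) (coordOp b g),
    ae_restrict_mem measurableSet_Ioo] with s h1 h2 h3 hs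
  have h2' : ratioOp b r 0 g s = _ := h2
  have h3' : convOp b r (coordOp b g) s = _ := h3
  rw [h1, h2', h3', ← integral_const_mul]
  apply integral_congr_ae
  filter_upwards [coeFn_coordOp g] with u hu
  have hs0 : (s : ℂ) ≠ 0 := by exact_mod_cast hs.1.ne'
  rw [hu, ratioKernel]
  push_cast
  field_simp
  simp

/-- The operator of multiplication by `exp (w t)` on `L₂(0,b)`. -/
def weightOp (b w : ℝ) : L2 b →L[ℂ] L2 b := mulOp (volume.restrict (Ioo 0 b)) (expFun w)

lemma coeFn_weightOp (w : ℝ) (g : L2 b) :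
    weightOp b w g =ᵐ[volume.restrict (Ioo 0 b)] fun t => expFun w t * g t :=
  coeFn_mulOp (memLp_expFun _ _) g

lemma weightOp_mul_neg {v w : ℝ} (h : v + w = 0) : weightOp b v * weightOp b w = 1 := by
  refine ContinuousLinearMap.ext fun g => Lp.ext ?_
  rw [mul_apply_eq_comp, one_apply_eq_self]
  filter_upwards [coeFn_weightOp v (weightOp b w g), coeFn_weightOp w g] with t h1 h2
  rw [h1, h2, ← mul_assoc, expFun, expFun, ← Complex.exp_add, ← add_mul, ← Complex.ofReal_add, h]
  simp

/-- Multiplication by `exp (w t)` as an invertible operator. -/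
def weightUnit (b w : ℝ) : (L2 b →L[ℂ] L2 b)ˣ :=
  ⟨weightOp b w, weightOp b (-w), weightOp_mul_neg (by ring), weightOp_mul_neg (by ring)⟩

lemma weightOp_mul_coordOp (w : ℝ) : weightOp b w * coordOp b = coordOp b * weightOp b w := by
  refine ContinuousLinearMap.ext fun g => Lp.ext ?_
  rw [mul_apply_eq_comp, mul_apply_eq_comp]
  filter_upwards [coeFn_weightOp w (coordOp b g), coeFn_coordOp (weightOp b w g),
    coeFn_weightOp w g, coeFn_coordOp g] with t h1 h2 h3 h4
  rw [h1, h2, h3, h4]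
  ring

/-- Since exp(ws)exp(-w(s - u)) = exp(wu), conjugation by the weight exchanges the damped and
undamped kernels. This similarity allows the norm to be made small. -/
lemma weightOp_mul_ratioOp (hr : MemLp r 2 (volume.restrict (Ioo 0 b))) {w : ℝ} (hw : 0 ≤ w) :
    weightOp b w * ratioOp b r w = ratioOp b r 0 * weightOp b w := by
  refine ContinuousLinearMap.ext fun g => Lp.ext ?_
  rw [mul_apply_eq_comp, mul_apply_eq_comp]
  filter_upwards [coeFn_weightOp w (ratioOp b r w g),
    coeFn_hilbertSchmidt (memLp_ratioKernel hr hw) g,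
    coeFn_hilbertSchmidt (memLp_ratioKernel hr le_rfl) (weightOp b w g)] with s h1 h2 h3
  have h2' : ratioOp b r w g s = _ := h2
  have h3' : ratioOp b r 0 (weightOp b w g) s = _ := h3
  rw [h1, h2', h3', ← integral_const_mul]
  apply integral_congr_ae
  filter_upwards [coeFn_weightOp w g] with u hu
  rw [hu, ratioKernel, ratioKernel, expFun, expFun]
  have h : Complex.exp (w * s) * Complex.exp (-(w * (s - u))) = Complex.exp (w * u) := by
    rw [← Complex.exp_add]
    congr 1
    ring
  push_cast
  simp only [← h, zero_mul, neg_zero, Complex.exp_zero]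
  ring

/-- As w grows the kernel tends to 0 pointwise, because s - u > 0 on its support, and it stays
dominated by the convolution kernel; dominated convergence sends its Hilbert–Schmidt norm to 0. -/
lemma exists_norm_ratioOp_lt (hr : MemLp r 2 (volume.restrict (Ioo 0 b))) {ε : ℝ} (hε : 0 < ε) :
    ∃ w : ℝ, 0 ≤ w ∧ ‖ratioOp b r w‖ < ε := by
  set ν := (volume.restrict (Ioo 0 b)).prod (volume.restrict (Ioo 0 b))
  have hm := fun n : ℕ => memLp_ratioKernel hr (Nat.cast_nonneg (α := ℝ) n)
  have h1 : Filter.Tendsto (fun n : ℕ => ∫⁻ z, ‖ratioKernel b r n z‖ₑ ^ (2 : ℝ) ∂ν)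
      Filter.atTop (nhds (∫⁻ _, 0 ∂ν)) := by
    refine tendsto_lintegral_of_dominated_convergence' (fun z => ‖convKernel b r z‖ₑ ^ (2 : ℝ))
      (fun n => (hm n).1.enorm.pow_const _) (fun n => ?_) ?_ ?_
    · filter_upwards [ae_mem_square] with z hz
      gcongr
      rw [enorm_le_iff_norm_le]
      exact norm_ratioKernel_le n.cast_nonneg hz
    · rw [← eLpNorm_two_sq]
      exact (ENNReal.rpow_lt_top_of_nonneg (by norm_num) (memLp_convKernel hr).2.ne).ne
    · refine Filter.Eventually.of_forall fun z => ?_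
      have h0 : Filter.Tendsto (fun n : ℕ => ratioKernel b r n z) Filter.atTop (nhds 0) := by
        by_cases h : z.1 - z.2 ∈ Ioo 0 b
        · have h2 : Filter.Tendsto (fun n : ℕ => Real.exp (-((n : ℝ) * (z.1 - z.2))))
              Filter.atTop (nhds 0) :=
            Real.tendsto_exp_neg_atTop_nhds_zero.comp
              (tendsto_natCast_atTop_atTop.atTop_mul_const h.1)
          have h3 := (h2.const_mul (z.2 / z.1)).ofReal.mul_const (convKernel b r z)
          simpa [ratioKernel] using h3
        · simp [ratioKernel, convKernel, indicator_of_notMem h]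
      have h2 := ((ENNReal.continuous_rpow_const (y := 2)).tendsto _).comp
        ((continuous_enorm.tendsto _).comp h0)
      simpa [Function.comp_def] using h2
  rw [lintegral_zero] at h1
  obtain ⟨n, hn⟩ := (h1.eventually_lt_const (u := ENNReal.ofReal ε ^ (2 : ℝ))
    (ENNReal.rpow_pos (ENNReal.ofReal_pos.2 hε) ENNReal.ofReal_ne_top)).exists
  rw [← eLpNorm_two_sq, ENNReal.rpow_lt_rpow_iff (by norm_num)] at hn
  refine ⟨n, n.cast_nonneg, (norm_hilbertSchmidt_le (hm n)).trans_lt ?_⟩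
  exact (ENNReal.lt_ofReal_iff_toReal_lt (hm n).2.ne).1 hn

lemma norm_coordOp_le (hb : 0 ≤ b) : ‖coordOp b‖ ≤ b := by
  refine norm_mulOp_le (memLp_of_continuousOn (by fun_prop) _) hb ?_
  filter_upwards [ae_restrict_mem measurableSet_Ioo] with x hx
  rw [Complex.norm_real, Real.norm_of_nonneg hx.1.le]
  exact hx.2.le

/-- The transformation operator on `L₂(0,b)`. -/
def transOp (b : ℝ) (r : ℝ → ℂ) : L2 b →L[ℂ] L2 b := expSeries (ratioOp b r 0) (coordOp b)

lemma isUnit_transOp (hb : 0 ≤ b) (hr : MemLp r 2 (volume.restrict (Ioo 0 b))) :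
    IsUnit (transOp b r) := by
  -- With ‖X‖ ≤ b this threshold keeps the product of norms below 1/2; b + 1 in place of b also
  -- covers b = 0.
  obtain ⟨w, hw, h⟩ := exists_norm_ratioOp_lt hr (ε := 1 / (2 * (b + 1))) (by positivity)
  refine isUnit_expSeries_of_conj (weightUnit b w) (weightOp_mul_ratioOp hr hw)
    (weightOp_mul_coordOp w) (isUnit_expSeries_of_small ?_)
  have h1 : ‖ratioOp b r w‖ * ‖coordOp b‖ ≤ 1 / (2 * (b + 1)) * b :=
    mul_le_mul h.le (norm_coordOp_le hb) (norm_nonneg _) (by positivity)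
  refine h1.trans_lt ?_
  rw [div_mul_eq_mul_div, div_lt_div_iff₀ (by positivity) (by norm_num)]
  linarith

/-- Push X through Aⁿ using XA = CX, replace Xⁿ⁺¹e by (n+1)!Eⁿ⁺¹e, and use (n+1)!/n! = n + 1. -/
lemma hasSum_coordOp_transOp_expL (hr : MemLp r 2 (volume.restrict (Ioo 0 b))) (z : ℂ) :
    HasSum (fun n : ℕ => (n + 1 : ℂ) • ((convOp b (expFun z) * convOp b r) ^ n)
      (convOp b (expFun z) (expL b z))) (coordOp b (transOp b r (expL b z))) := by
  have h1 := (coordOp b).hasSum ((ContinuousLinearMap.apply ℂ (L2 b) (expL b z)).hasSum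
    (hasSum_expSeries (ratioOp b r 0) (coordOp b)))
  refine h1.congr_fun fun n => ?_
  have h2 : SemiconjBy (coordOp b) (ratioOp b r 0) (convOp b r) := coordOp_mul_ratioOp hr
  have h3 := (h2.pow_right n).eq
  have h4 : (coordOp b ^ (n + 1)) (expL b z) =
      ((n + 1).factorial : ℂ) • (convOp b (expFun z) ^ (n + 1)) (expL b z) := by
    rw [convOp_pow_expL, smul_smul, mul_inv_cancel₀ (by exact_mod_cast (n + 1).factorial_ne_zero),
      one_smul]
  have h5 : coordOp b ((ratioOp b r 0 ^ n) ((coordOp b ^ n) (expL b z))) =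
      (convOp b r ^ n) ((coordOp b ^ (n + 1)) (expL b z)) := by
    rw [pow_succ' (coordOp b)]
    exact congrArg (fun T : L2 b →L[ℂ] L2 b => T ((coordOp b ^ n) (expL b z))) h3
  simp only [ContinuousLinearMap.apply_apply]
  rw [smul_apply, map_smul, mul_apply_eq_comp, h5, h4, map_smul, smul_smul,
    (convOp_commute (memLp_expFun z 2) hr).mul_pow, pow_succ (convOp b (expFun z)),
    (convOp_commute (memLp_expFun z 2) hr).pow_pow n n |>.eq]
  have h6 : ((n.factorial : ℂ)⁻¹) * ((n + 1).factorial : ℂ) = n + 1 := by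
    rw [Nat.factorial_succ]
    push_cast
    have : (n.factorial : ℂ) ≠ 0 := by exact_mod_cast n.factorial_ne_zero
    field_simp
  rw [h6]
  rfl

/-- The series ∑ (n+1)Bⁿu is formally (1 - B)⁻²u; two telescoping subtractions verify this without
inverting 1 - B. -/
lemma coordOp_transOp_expL_eq (hr : MemLp r 2 (volume.restrict (Ioo 0 b))) (z : ℂ) :
    (1 - convOp b (expFun z) * convOp b r) ((1 - convOp b (expFun z) * convOp b r)
      (coordOp b (transOp b r (expL b z)))) = convOp b (expFun z) (expL b z) := by
  set B := convOp b (expFun z) * convOp b r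
  set u := convOp b (expFun z) (expL b z)
  set Y := coordOp b (transOp b r (expL b z))
  have h1 : HasSum (fun n : ℕ => (n + 1 : ℂ) • (B ^ n) u) Y := hasSum_coordOp_transOp_expL hr z
  have h2 : HasSum (fun n : ℕ => (n : ℂ) • (B ^ n) u) (B Y) := by
    refine (hasSum_nat_add_iff' 1).1 ?_
    simp only [Finset.range_one, Finset.sum_singleton, Nat.cast_zero, zero_smul, sub_zero]
    refine (B.hasSum h1).congr_fun fun n => ?_
    simp only [map_smul, pow_succ', mul_apply_eq_comp]
    push_cast
    rfl
  have h3 : HasSum (fun n : ℕ => (B ^ n) u) ((1 - B) Y) := by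
    refine (h1.sub h2).congr_fun fun n => ?_
    rw [add_smul, one_smul]
    abel
  have h4 : HasSum (fun n : ℕ => (B ^ (n + 1)) u) (B ((1 - B) Y)) := by
    refine (B.hasSum h3).congr_fun fun n => ?_
    simp only [pow_succ', mul_apply_eq_comp]
  have h5 := (hasSum_nat_add_iff' 1).2 h3
  simp only [Finset.range_one, Finset.sum_singleton, pow_zero, one_apply_eq_self] at h5
  have h6 := h5.unique h4
  have h7 : (1 - B) ((1 - B) Y) = (1 - B) Y - B ((1 - B) Y) := rfl
  rw [h7, ← h6]
  abel

lemma norm_pow_apply_le {H : Type*} [NormedAddCommGroup H] [NormedSpace ℂ H] (A : H →L[ℂ] H)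
    (n : ℕ) (v : H) : ‖(A ^ n) v‖ ≤ ‖A‖ ^ n * ‖v‖ := by
  induction n with
  | zero => simp
  | succ n ih =>
    rw [pow_succ', mul_apply_eq_comp, pow_succ', mul_assoc]
    exact A.le_opNorm_of_le ih

/-- A fixed vector v of EC is (EC)ⁿ⁺¹v for all n. With w = Cⁿ⁺¹v this is the convolution of w with
Eⁿe = Xⁿe/n!, so its norm is O(Rⁿ/n!) for a constant R and v = 0. -/
lemma eq_zero_of_eq_convOp (hb : 0 ≤ b) (hr : MemLp r 2 (volume.restrict (Ioo 0 b))) (z : ℂ)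
    {v : L2 b} (hv : (1 - convOp b (expFun z) * convOp b r) v = 0) : v = 0 := by
  set E := convOp b (expFun z)
  set C := convOp b r
  have h1 : v = (E * C) v := sub_eq_zero.1 hv
  have h2 : ∀ n : ℕ, v = ((E * C) ^ n) v := fun n => by
    induction n with
    | zero => rfl
    | succ n ih => rw [pow_succ, mul_apply_eq_comp, ← h1, ← ih]
  have h3 : ∀ n : ℕ, ‖v‖ ≤ (Real.sqrt b * (‖C‖ * ‖v‖) * ‖expL b z‖) *
      ((‖C‖ * ‖coordOp b‖) ^ n / n.factorial) := fun n => by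
    set w := (C ^ (n + 1)) v
    have hw : ‖w‖ ≤ ‖C‖ ^ (n + 1) * ‖v‖ := norm_pow_apply_le C (n + 1) v
    have hX : ‖(coordOp b ^ n) (expL b z)‖ ≤ ‖coordOp b‖ ^ n * ‖expL b z‖ :=
      norm_pow_apply_le _ n _
    have hEw : E w = convOp b w (expL b z) := by
      rw [convOp_comm, convOp_congr (Lp.memLp _) (coeFn_expL z)]
    have hwE : Commute (convOp b w) E := convOp_commute (Lp.memLp w) (memLp_expFun z 2)
    have hEC : Commute E C := convOp_commute (memLp_expFun z 2) hr
    have h5 : v = ((n.factorial : ℂ)⁻¹) • convOp b w ((coordOp b ^ n) (expL b z)) := by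
      calc v = ((E * C) ^ (n + 1)) v := h2 (n + 1)
        _ = (E ^ n) (E w) := by rw [hEC.mul_pow, pow_succ E]; rfl
        _ = convOp b w ((E ^ n) (expL b z)) := by
          rw [hEw]
          exact congrArg (fun T : L2 b →L[ℂ] L2 b => T (expL b z)) (hwE.pow_right n).eq.symm
        _ = _ := by rw [convOp_pow_expL, map_smul]
    calc ‖v‖ = (n.factorial : ℝ)⁻¹ * ‖convOp b w ((coordOp b ^ n) (expL b z))‖ := by
          conv_lhs => rw [h5]
          rw [norm_smul, norm_inv, RCLike.norm_natCast]
      _ ≤ (n.factorial : ℝ)⁻¹ * ((Real.sqrt b * ‖w‖) * ‖(coordOp b ^ n) (expL b z)‖) := by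
          gcongr
          exact (convOp b w).le_of_opNorm_le (norm_convOp_le hb w) _
      _ ≤ (n.factorial : ℝ)⁻¹ * ((Real.sqrt b * (‖C‖ ^ (n + 1) * ‖v‖)) *
          (‖coordOp b‖ ^ n * ‖expL b z‖)) := by gcongr
      _ = _ := by
          rw [pow_succ, mul_pow, div_eq_inv_mul]
          ring
  have h4 := (FloorSemiring.tendsto_pow_div_factorial_atTop (‖C‖ * ‖coordOp b‖)).const_mul
    (Real.sqrt b * (‖C‖ * ‖v‖) * ‖expL b z‖)
  rw [mul_zero] at h4
  exact norm_le_zero_iff.1 (ge_of_tendsto' h4 h3)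

/-- Both sides solve (1 - EC)²u = c²Ee, and 1 - EC is injective. -/
lemma convOp_eq_transOp (hb : 0 ≤ b) (hr : MemLp r 2 (volume.restrict (Ioo 0 b))) {z c : ℂ}
    {f g : L2 b} (hf : f = c • expL b z + convOp b (expFun z) (convOp b r f))
    (hg : g = c • expL b z + convOp b (expFun z) (convOp b r g)) :
    convOp b f g = c ^ 2 • coordOp b (transOp b r (expL b z)) := by
  set E := convOp b (expFun z) with hE
  set C := convOp b r with hC
  have hEC : Commute E C := convOp_commute (memLp_expFun z 2) hr
  have hfE : Commute (convOp b f) E := convOp_commute (Lp.memLp f) (memLp_expFun z 2)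
  have hfC : Commute (convOp b f) C := convOp_commute (Lp.memLp f) hr
  have hfe : convOp b f (expL b z) = E f := by
    rw [convOp_comm, convOp_congr (Lp.memLp _) (coeFn_expL z)]
  have h1 : (1 - E * C) (convOp b f g) = c • E f := by
    have h2 : (E * C) (convOp b f g) = convOp b f (E (C g)) :=
      congrArg (fun T : L2 b →L[ℂ] L2 b => T g) (hfE.mul_right hfC).eq.symm
    have h3 : E (C g) = g - c • expL b z := eq_sub_of_add_eq' hg.symm
    have h4 : (1 - E * C) (convOp b f g) = convOp b f g - (E * C) (convOp b f g) := rfl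
    rw [h4, h2, h3, map_sub, map_smul, hfe]
    abel
  have h5 : (1 - E * C) (E f) = c • E (expL b z) := by
    have h2 : (E * C) (E f) = E (E (C f)) :=
      congrArg (fun T : L2 b →L[ℂ] L2 b => E (T f)) hEC.eq.symm
    have h3 : E (C f) = f - c • expL b z := eq_sub_of_add_eq' hf.symm
    have h4 : (1 - E * C) (E f) = E f - (E * C) (E f) := rfl
    rw [h4, h2, h3, map_sub, map_smul]
    abel
  have h6 := coordOp_transOp_expL_eq hr z
  rw [← hE, ← hC] at h6
  refine sub_eq_zero.1 (eq_zero_of_eq_convOp hb hr z (eq_zero_of_eq_convOp hb hr z ?_))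
  rw [← hE, ← hC, map_sub, map_sub, map_smul, map_smul, h6, h1, map_smul, h5, smul_smul, sq,
    sub_self]

end Operators

/-! ### Absolutely continuous complex functions. -/

section AbsolutelyContinuous

variable {f g : ℝ → ℂ} {a b : ℝ}

lemma absolutelyContinuousOnInterval_comp_lipschitz {X Y : Type*} [PseudoMetricSpace X]
    [PseudoMetricSpace Y] {f : ℝ → X} {φ : X → Y} (hφ : ∀ x y, dist (φ x) (φ y) ≤ dist x y)
    (hf : AbsolutelyContinuousOnInterval f a b) :
    AbsolutelyContinuousOnInterval (fun x => φ (f x)) a b := by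
  rw [absolutelyContinuousOnInterval_iff] at hf ⊢
  intro ε hε
  obtain ⟨δ, hδ, h⟩ := hf ε hε
  refine ⟨δ, hδ, fun E hE hE' => (Finset.sum_le_sum fun i _ => ?_).trans_lt (h E hE hE')⟩
  exact hφ _ _

lemma absolutelyContinuousOnInterval_comp_sub {X : Type*} [PseudoMetricSpace X]
    {f : ℝ → X} (hf : AbsolutelyContinuousOnInterval f 0 b) :
    AbsolutelyContinuousOnInterval (fun x => f (b - x)) 0 b := by
  rw [absolutelyContinuousOnInterval_iff] at hf ⊢
  intro ε hε
  obtain ⟨δ, hδ, h⟩ := hf ε hε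
  refine ⟨δ, hδ, fun E hE hE' => ?_⟩
  have key := h (E.1, fun i => (b - (E.2 i).1, b - (E.2 i).2)) ?_ ?_
  · exact key
  · obtain ⟨h1, h2⟩ := hE
    have hm : ∀ x ∈ uIcc 0 b, b - x ∈ uIcc 0 b := fun x hx => by
      rw [mem_uIcc] at hx ⊢
      rcases hx with hx | hx
      · exact Or.inl ⟨by linarith, by linarith⟩
      · exact Or.inr ⟨by linarith, by linarith⟩
    refine ⟨fun i hi => ⟨hm _ (h1 i hi).1, hm _ (h1 i hi).2⟩, fun i hi j hj hij => ?_⟩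
    have h3 := h2 hi hj hij
    simp only [Function.onFun, uIoc, Ioc_disjoint_Ioc] at h3 ⊢
    grind
  · refine lt_of_eq_of_lt (Finset.sum_congr rfl fun i _ => ?_) hE'
    exact dist_sub_left _ _ _

lemma integrableOn_and_integral_eq_sub_real {f g : ℝ → ℝ} (hab : a ≤ b)
    (hf : AbsolutelyContinuousOnInterval f a b)
    (h : ∀ᵐ x ∂(volume.restrict (Ioo a b)), HasDerivAt f (g x) x) :
    IntegrableOn g (Ioo a b) ∧ ∫ x in Ioo a b, g x = f b - f a := by
  have h1 : deriv f =ᵐ[volume.restrict (Ioo a b)] g := h.mono fun x hx => hx.deriv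
  have h2 := (intervalIntegrable_iff_integrableOn_Ioo_of_le hab).1 hf.intervalIntegrable_deriv
  refine ⟨h2.congr h1, ?_⟩
  rw [← hf.integral_deriv_eq_sub, intervalIntegral.integral_of_le hab,
    integral_Ioc_eq_integral_Ioo]
  exact (integral_congr_ae h1).symm

lemma integrableOn_and_integral_eq_sub (hab : a ≤ b)
    (hf : AbsolutelyContinuousOnInterval f a b)
    (h : ∀ᵐ x ∂(volume.restrict (Ioo a b)), HasDerivAt f (g x) x) :
    IntegrableOn g (Ioo a b) ∧ ∫ x in Ioo a b, g x = f b - f a := by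
  have hre := integrableOn_and_integral_eq_sub_real (g := fun x => (g x).re) hab
    (absolutelyContinuousOnInterval_comp_lipschitz (φ := Complex.re)
      (fun x y => by simpa [dist_eq_norm] using Complex.abs_re_le_norm (x - y)) hf)
    (h.mono fun x hx => (Complex.reCLM.hasFDerivAt.comp_hasDerivAt x hx))
  have him := integrableOn_and_integral_eq_sub_real (g := fun x => (g x).im) hab
    (absolutelyContinuousOnInterval_comp_lipschitz (φ := Complex.im)
      (fun x y => by simpa [dist_eq_norm] using Complex.abs_im_le_norm (x - y)) hf)
    (h.mono fun x hx => (Complex.imCLM.hasFDerivAt.comp_hasDerivAt x hx))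
  have h1 : IntegrableOn (fun x => ((g x).re : ℂ) + ((g x).im : ℂ) * Complex.I) (Ioo a b) :=
    hre.1.ofReal.add (him.1.ofReal.mul_const _)
  have h2 : ∫ x in Ioo a b, (((g x).re : ℂ) + ((g x).im : ℂ) * Complex.I) = f b - f a := by
    rw [integral_add hre.1.ofReal (him.1.ofReal.mul_const _), integral_mul_const,
      integral_complex_ofReal, integral_complex_ofReal, hre.2, him.2]
    apply Complex.ext <;> simp
  simp only [Complex.re_add_im] at h1 h2
  exact ⟨h1, h2⟩

end AbsolutelyContinuous

/-! ### The scalar equation in integral form. -/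

section ScalarEquation

/-- `f` is an absolutely continuous solution of `f' = z f + r * f` on `(0,π)`. -/
structure IsScalarSolution (r : ℝ → ℂ) (z : ℂ) (f : ℝ → ℂ) : Prop where
  ac : AbsolutelyContinuousOnInterval f 0 Real.pi
  eq : ∀ᵐ x ∂(volume.restrict (Ioo 0 Real.pi)),
    HasDerivAt f (z * f x + conv Real.pi r f x) x

variable {r f : ℝ → ℂ} {z : ℂ} {b : ℝ}

lemma IsScalarSolution.continuousOn (hf : IsScalarSolution r z f) :
    ContinuousOn f (Icc 0 Real.pi) := by
  have := hf.ac.continuousOn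
  rwa [uIcc_of_le Real.pi_pos.le] at this

lemma hasDerivAt_expFun (z : ℂ) (x : ℝ) : HasDerivAt (expFun z) (z * expFun z x) x := by
  have h1 : HasDerivAt (fun t : ℝ => z * (t : ℂ)) z x := by
    simpa using (Complex.ofRealCLM.hasDerivAt (x := x)).const_mul z
  have := h1.cexp
  rw [mul_comm z]
  exact this

lemma absolutelyContinuousOnInterval_expFun (z : ℂ) (a b : ℝ) :
    AbsolutelyContinuousOnInterval (expFun z) a b := by
  refine ContDiffOn.absolutelyContinuousOnInterval (ContDiff.contDiffOn ?_)
  unfold expFun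
  exact (contDiff_const.mul Complex.ofRealCLM.contDiff).cexp

lemma expFun_neg_mul (z : ℂ) (x : ℝ) : expFun z x * expFun (-z) x = 1 := by
  simp [expFun, ← Complex.exp_add]

/-- Variation of constants: integrate the derivative of exp(-zt)f(t) from 0 to x. -/
lemma IsScalarSolution.eq_add_integral (hf : IsScalarSolution r z f) {x : ℝ}
    (hx : x ∈ Ioc 0 Real.pi) :
    f x = f 0 * expFun z x + ∫ t in (0 : ℝ)..x, expFun z (x - t) * conv Real.pi r f t := by
  have hac : AbsolutelyContinuousOnInterval (fun t => expFun (-z) t • f t) 0 x :=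
    (absolutelyContinuousOnInterval_expFun (-z) 0 x).fun_smul
      (hf.ac.mono (by
        rw [uIcc_of_le hx.1.le, uIcc_of_le Real.pi_pos.le]
        exact Icc_subset_Icc_right hx.2))
  have hd : ∀ᵐ t ∂(volume.restrict (Ioo 0 x)), HasDerivAt (fun t => expFun (-z) t • f t)
      (expFun (-z) t * conv Real.pi r f t) t := by
    filter_upwards [ae_restrict_of_ae_restrict_of_subset (Ioo_subset_Ioo_right hx.2) hf.eq]
      with t ht
    have := (hasDerivAt_expFun (-z) t).mul ht
    convert! this using 1
    ring
  have h1 := (integrableOn_and_integral_eq_sub hx.1.le hac hd).2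
  rw [intervalIntegral.integral_of_le hx.1.le, integral_Ioc_eq_integral_Ioo]
  have h2 : ∀ t, expFun z (x - t) * conv Real.pi r f t =
      expFun z x * (expFun (-z) t * conv Real.pi r f t) := fun t => by
    rw [← expFun_sub z x t]
    linear_combination (-expFun z (x - t) * conv Real.pi r f t) * expFun_neg_mul z t
  simp only [h2]
  rw [integral_const_mul, h1]
  simp only [smul_eq_mul]
  have h3 : expFun (-z) 0 = 1 := by simp [expFun]
  rw [h3]
  linear_combination -f x * expFun_neg_mul z x

lemma conv_eq_conv_of_le {k g : ℝ → ℂ} {b c : ℝ} (hbc : b ≤ c) {x : ℝ} (hx : x ∈ Ioc 0 b) :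
    conv b k g x = conv c k g x := by
  rw [conv_eq_intervalIntegral hx, conv_eq_intervalIntegral ⟨hx.1, hx.2.trans hbc⟩]

lemma IsScalarSolution.memLp (hf : IsScalarSolution r z f) (hb : b ≤ Real.pi) :
    MemLp f 2 (volume.restrict (Ioo 0 b)) :=
  memLp_of_continuousOn (hf.continuousOn.mono (Icc_subset_Icc_right hb)) 2

lemma IsScalarSolution.toLp_eq (hf : IsScalarSolution r z f) (hb : b ≤ Real.pi)
    (hr : MemLp r 2 (volume.restrict (Ioo 0 b))) :
    (hf.memLp hb).toLp = f 0 • expL b z +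
      convOp b (expFun z) (convOp b r (hf.memLp hb).toLp) := by
  set F := (hf.memLp hb).toLp
  have hF : F =ᵐ[volume.restrict (Ioo 0 b)] f := MemLp.coeFn_toLp _
  apply Lp.ext
  filter_upwards [hF, Lp.coeFn_add (f 0 • expL b z) (convOp b (expFun z) (convOp b r F)),
    Lp.coeFn_smul (f 0) (expL b z), coeFn_expL z,
    coeFn_convOp (memLp_expFun z 2) (convOp b r F), ae_restrict_mem measurableSet_Ioo]
    with x h1 h2 h3 h4 h5 hx
  rw [h1, h2, Pi.add_apply, h3, h5, Pi.smul_apply, h4, smul_eq_mul,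
    hf.eq_add_integral ⟨hx.1, hx.2.le.trans hb⟩,
    conv_congr (Filter.EventuallyEq.refl _ _) (coeFn_convOp hr F),
    conv_eq_intervalIntegral (Ioo_subset_Ioc_self hx)]
  congr 1
  refine intervalIntegral.integral_congr_ae (Filter.Eventually.of_forall fun t ht => ?_)
  rw [uIoc_of_le hx.1.le] at ht
  rw [conv_congr (Filter.EventuallyEq.refl _ _) hF,
    conv_eq_conv_of_le hb ⟨ht.1, ht.2.trans hx.2.le⟩]

end ScalarEquation

/-! ### The Lagrange identity for two scalar equations. -/

section Lagrange

variable {r r' f g : ℝ → ℂ} {z : ℂ} {a b : ℝ}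

lemma MemL2Pi.aestronglyMeasurable (hr : MemL2Pi r) :
    AEStronglyMeasurable r (volume.restrict (Ioo 0 Real.pi)) := by
  have hm : Measurable fun x : ℝ => (((Real.pi - x : ℝ) : ℂ))⁻¹ := by fun_prop
  refine (hm.aestronglyMeasurable.mul hr.1).congr ?_
  filter_upwards [ae_restrict_mem measurableSet_Ioo] with x hx
  have : ((Real.pi - x : ℝ) : ℂ) ≠ 0 := by
    exact_mod_cast (sub_pos.2 hx.2).ne'
  simp only [Pi.mul_apply]
  field_simp

lemma MemL2Pi.memLp (hr : MemL2Pi r) (hb : b < Real.pi) :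
    MemLp r 2 (volume.restrict (Ioo 0 b)) := by
  have hsub : Ioo 0 b ⊆ Ioo 0 Real.pi := Ioo_subset_Ioo_right hb.le
  have h1 := hr.mono_measure (Measure.restrict_mono_set volume hsub)
  refine h1.of_le_mul (c := (Real.pi - b)⁻¹)
    (hr.aestronglyMeasurable.mono_measure (Measure.restrict_mono_set volume hsub)) ?_
  filter_upwards [ae_restrict_mem measurableSet_Ioo] with x hx
  have h2 : 0 < Real.pi - b := sub_pos.2 hb
  rw [norm_mul, Complex.norm_real, Real.norm_of_nonneg (by linarith [hx.2]), ← mul_assoc]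
  refine le_mul_of_one_le_left (norm_nonneg _) ?_
  rw [inv_mul_eq_div, one_le_div h2]
  linarith [hx.2]

lemma MemL2Pi.sub (hr : MemL2Pi r) (hr' : MemL2Pi r') : MemL2Pi fun x => r x - r' x := by
  have h := MemLp.sub hr hr'
  refine h.ae_eq (Filter.Eventually.of_forall fun x => ?_)
  simp only [Pi.sub_apply]
  ring

lemma MemL2Pi.integrable_norm (hr : MemL2Pi r) :
    Integrable fun s => ‖(Ioo 0 Real.pi).indicator r s‖ * (Real.pi - s) := by
  have h1 : Integrable (fun x : ℝ => ((Real.pi - x : ℝ) : ℂ) * r x)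
      (volume.restrict (Ioo 0 Real.pi)) :=
    memLp_one_iff_integrable.1 (MemLp.mono_exponent hr (by norm_num))
  have h2 := ((integrable_indicator_iff measurableSet_Ioo).2 h1).norm
  refine h2.congr (Filter.Eventually.of_forall fun s => ?_)
  by_cases hs : s ∈ Ioo 0 Real.pi
  · simp only [indicator_of_mem hs, norm_mul, Complex.norm_real]
    rw [Real.norm_of_nonneg (by linarith [hs.2]), mul_comm]
  · simp [indicator_of_notMem hs]

/-- Here r need not be integrable near π. For fixed s the integrand in x is supported in (s,π),
whose length π - s supplies exactly the weight that makes r integrable. -/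
lemma integrable_conv_mul_aux (hr : MemL2Pi r) (hf : ContinuousOn f (Icc 0 Real.pi))
    (hg : ContinuousOn g (Icc 0 Real.pi)) :
    Integrable (fun w : ℝ × ℝ => (Ioo 0 Real.pi).indicator f (w.1 - w.2) *
      (Ioo 0 Real.pi).indicator r w.2 * (Ioo 0 Real.pi).indicator g (Real.pi - w.1))
      (volume.prod volume) := by
  obtain ⟨M, hM⟩ := isCompact_Icc.exists_bound_of_continuousOn hf
  obtain ⟨N, hN⟩ := isCompact_Icc.exists_bound_of_continuousOn hg
  have hM0 : 0 ≤ M := (norm_nonneg _).trans (hM 0 (left_mem_Icc.2 Real.pi_pos.le))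
  have hN0 : 0 ≤ N := (norm_nonneg _).trans (hN 0 (left_mem_Icc.2 Real.pi_pos.le))
  set F := (Ioo 0 Real.pi).indicator f with hF
  set R := (Ioo 0 Real.pi).indicator r with hR
  set G := (Ioo 0 Real.pi).indicator g with hG
  have hF2 : MemLp F 2 volume := memLp_indicator (memLp_of_continuousOn hf 2)
  have hG2 : MemLp (fun x => G (Real.pi - x)) 2 volume :=
    (memLp_indicator (memLp_of_continuousOn hg 2)).comp_measurePreserving
      (Measure.measurePreserving_sub_left volume Real.pi)
  have hRm : AEStronglyMeasurable R volume :=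
    (aestronglyMeasurable_indicator_iff measurableSet_Ioo).2 hr.aestronglyMeasurable
  have hm : AEStronglyMeasurable (fun w : ℝ × ℝ => F (w.1 - w.2) * R w.2 * G (Real.pi - w.1))
      (volume.prod volume) :=
    ((hF2.1.comp_quasiMeasurePreserving (quasiMeasurePreserving_sub volume volume)).mul
      hRm.comp_snd).mul hG2.1.comp_fst
  have hFs : ∀ s, MemLp (fun x => F (x - s)) 2 volume := fun s =>
    hF2.comp_measurePreserving (measurePreserving_sub_right volume s)
  rw [integrable_prod_iff' hm]
  refine ⟨Filter.Eventually.of_forall fun s => ?_, ?_⟩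
  · refine (((hFs s).integrable_mul hG2).mul_const (R s)).congr
      (Filter.Eventually.of_forall fun x => ?_)
    simp only [Pi.mul_apply]
    ring
  · refine (hr.integrable_norm.const_mul (M * N)).mono'
      hm.prod_swap.norm.integral_prod_right' (Filter.Eventually.of_forall fun s => ?_)
    dsimp only
    rw [Real.norm_of_nonneg (by positivity), ← hR]
    by_cases hs : s ∈ Ioo 0 Real.pi
    · have h1 : ∀ x, ‖F (x - s) * R s * G (Real.pi - x)‖ ≤
          (Ioo s Real.pi).indicator (fun _ => M * N * ‖R s‖) x := fun x => by
        by_cases hx : x ∈ Ioo s Real.pi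
        · have hx1 : x - s ∈ Ioo 0 Real.pi := ⟨by linarith [hx.1], by linarith [hx.2, hs.1]⟩
          have hx2 : Real.pi - x ∈ Ioo 0 Real.pi :=
            ⟨by linarith [hx.2], by linarith [hx.1, hs.1]⟩
          rw [indicator_of_mem hx, norm_mul, norm_mul, hF, hG, indicator_of_mem hx1,
            indicator_of_mem hx2, mul_right_comm]
          gcongr
          · exact hM _ (Ioo_subset_Icc_self hx1)
          · exact hN _ (Ioo_subset_Icc_self hx2)
        · rw [indicator_of_notMem hx]
          by_cases hx1 : x - s ∈ Ioo 0 Real.pi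
          · have hx2 : Real.pi - x ∉ Ioo 0 Real.pi := fun h =>
              hx ⟨by linarith [hx1.1], by linarith [h.1]⟩
            rw [hG, indicator_of_notMem hx2, mul_zero, norm_zero]
          · rw [hF, indicator_of_notMem hx1, zero_mul, zero_mul, norm_zero]
      refine (integral_mono_of_nonneg (Filter.Eventually.of_forall fun x => norm_nonneg _)
        ((integrable_indicator_iff measurableSet_Ioo).2 (integrableOn_const (by simp)))
        (Filter.Eventually.of_forall h1)).trans_eq ?_
      rw [integral_indicator measurableSet_Ioo, setIntegral_const, smul_eq_mul,
        Real.volume_real_Ioo_of_le hs.2.le]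
      ring
    · rw [hR, indicator_of_notMem hs]
      simp

lemma integrable_conv_mul (hr : MemL2Pi r) (hf : ContinuousOn f (Icc 0 Real.pi))
    (hg : ContinuousOn g (Icc 0 Real.pi)) :
    Integrable (fun x => conv Real.pi r f x * (Ioo 0 Real.pi).indicator g (Real.pi - x)) := by
  refine (integrable_conv_mul_aux hr hf hg).integral_prod_left.congr
    (Filter.Eventually.of_forall fun x => ?_)
  dsimp only
  rw [integral_mul_const, conv_comm, conv]

lemma integrable_mul_conv (hr : MemL2Pi r) (hf : ContinuousOn f (Icc 0 Real.pi))
    (hg : ContinuousOn g (Icc 0 Real.pi)) :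
    Integrable (fun s => (Ioo 0 Real.pi).indicator r s * conv Real.pi f g (Real.pi - s)) ∧
    ∫ x, conv Real.pi r f x * (Ioo 0 Real.pi).indicator g (Real.pi - x) =
      ∫ s, (Ioo 0 Real.pi).indicator r s * conv Real.pi f g (Real.pi - s) := by
  have h1 := integrable_conv_mul_aux hr hf hg
  have h2 : ∀ s, ∫ x, (Ioo 0 Real.pi).indicator f (x - s) * (Ioo 0 Real.pi).indicator r s *
      (Ioo 0 Real.pi).indicator g (Real.pi - x) =
      (Ioo 0 Real.pi).indicator r s * conv Real.pi f g (Real.pi - s) := fun s => by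
    rw [conv, ← integral_const_mul, ← integral_sub_left_eq_self _ volume Real.pi]
    congr 1
    ext x
    rw [sub_sub_cancel, sub_right_comm]
    ring
  refine ⟨h1.integral_prod_right.congr (Filter.Eventually.of_forall h2), ?_⟩
  calc _ = ∫ x, ∫ s, (Ioo 0 Real.pi).indicator f (x - s) * (Ioo 0 Real.pi).indicator r s *
        (Ioo 0 Real.pi).indicator g (Real.pi - x) := by
        congr 1
        ext x
        rw [integral_mul_const, conv_comm, conv]
    _ = _ := by
        rw [integral_integral_swap h1]
        simp only [h2]

/-- Differentiating f(x)g(π - x) cancels the terms in z; Fubini and commutativity turn the two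
remaining integrals into pairings of r and r' with the same f * g. -/
lemma IsScalarSolution.lagrange_identity (hr : MemL2Pi r) (hr' : MemL2Pi r')
    (hf : IsScalarSolution r z f) (hg : IsScalarSolution r' z g) :
    f Real.pi * g 0 - f 0 * g Real.pi =
      ∫ s, ((Ioo 0 Real.pi).indicator r s - (Ioo 0 Real.pi).indicator r' s) *
        conv Real.pi f g (Real.pi - s) := by
  have hac : AbsolutelyContinuousOnInterval (fun x => f x • g (Real.pi - x)) 0 Real.pi :=
    hf.ac.fun_smul (absolutelyContinuousOnInterval_comp_sub hg.ac)
  have hrefl : ∀ᵐ x ∂(volume.restrict (Ioo 0 Real.pi)), HasDerivAt g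
      (z * g (Real.pi - x) + conv Real.pi r' g (Real.pi - x)) (Real.pi - x) := by
    have h := hg.eq
    rw [ae_restrict_iff' measurableSet_Ioo] at h ⊢
    filter_upwards [(quasiMeasurePreserving_sub_left volume Real.pi).ae h] with x hx hx'
    exact hx ⟨by linarith [hx'.2], by linarith [hx'.1]⟩
  have hd : ∀ᵐ x ∂(volume.restrict (Ioo 0 Real.pi)),
      HasDerivAt (fun x => f x • g (Real.pi - x))
        (conv Real.pi r f x * (Ioo 0 Real.pi).indicator g (Real.pi - x) -
          conv Real.pi r' g (Real.pi - x) * (Ioo 0 Real.pi).indicator f x) x := by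
    filter_upwards [hf.eq, hrefl, ae_restrict_mem measurableSet_Ioo] with x h1 h2 hx
    have hx' : Real.pi - x ∈ Ioo 0 Real.pi := ⟨by linarith [hx.2], by linarith [hx.1]⟩
    have h3 := h1.mul (h2.scomp x ((hasDerivAt_id x).const_sub Real.pi))
    rw [indicator_of_mem hx, indicator_of_mem hx']
    convert! h3 using 1
    simp
    ring
  have h1 := (integrableOn_and_integral_eq_sub Real.pi_pos.le hac hd).2
  simp only [smul_eq_mul, sub_self, sub_zero] at h1
  rw [← h1, setIntegral_eq_integral_of_forall_compl_eq_zero]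
  · have e1 := integrable_mul_conv hr hf.continuousOn hg.continuousOn
    have e2 := integrable_mul_conv hr' hg.continuousOn hf.continuousOn
    have i1 := integrable_conv_mul hr hf.continuousOn hg.continuousOn
    have i2 := (integrable_conv_mul hr' hg.continuousOn hf.continuousOn).comp_sub_left Real.pi
    simp only [sub_sub_cancel] at i2
    rw [integral_sub i1 i2, e1.2]
    have e3 : ∫ x, conv Real.pi r' g (Real.pi - x) * (Ioo 0 Real.pi).indicator f x =
        ∫ s, (Ioo 0 Real.pi).indicator r' s * conv Real.pi f g (Real.pi - s) := by
      rw [← integral_sub_left_eq_self _ volume Real.pi]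
      simp only [sub_sub_cancel]
      rw [e2.2]
      simp only [conv_comm (k := g)]
    rw [e3, ← integral_sub e1.1]
    · congr 1
      ext s
      ring
    · refine e2.1.congr (Filter.Eventually.of_forall fun s => ?_)
      simp only [conv_comm (k := g)]
  · intro x hx
    have hx' : Real.pi - x ∉ Ioo 0 Real.pi := fun h => hx ⟨by linarith [h.2], by linarith [h.1]⟩
    rw [indicator_of_notMem hx, indicator_of_notMem hx']
    ring

end Lagrange

/-! ### An exponential transform for the difference of endpoint values. -/

section Representation

variable {r r' f g : ℝ → ℂ} {z : ℂ} {a b : ℝ}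

lemma ae_restrict_of_reflect {P : ℝ → Prop} {a c : ℝ}
    (h : ∀ᵐ x ∂(volume.restrict (Ioo 0 (c - a))), P (c - x)) :
    ∀ᵐ x ∂(volume.restrict (Ioo a c)), P x := by
  rw [ae_restrict_iff' measurableSet_Ioo] at h ⊢
  filter_upwards [(quasiMeasurePreserving_sub_left volume c).ae h] with x hx hx'
  simpa using hx ⟨by linarith [hx'.2], by linarith [hx'.1]⟩

lemma MemL2Pi.memLp_reflect (hr : MemL2Pi r) (hb : b ≤ Real.pi) :
    MemLp (fun s : ℝ => (s : ℂ) * r (Real.pi - s)) 2 (volume.restrict (Ioo 0 b)) := by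
  have h1 : MemLp ((Ioo 0 Real.pi).indicator fun x : ℝ => ((Real.pi - x : ℝ) : ℂ) * r x) 2
      volume := memLp_indicator hr
  have h2 := (h1.comp_measurePreserving
    (Measure.measurePreserving_sub_left volume Real.pi)).restrict (Ioo 0 b)
  refine h2.ae_eq ?_
  filter_upwards [ae_restrict_mem measurableSet_Ioo] with s hs
  have : Real.pi - s ∈ Ioo 0 Real.pi := ⟨by linarith [hs.2], by linarith [hs.1]⟩
  rw [Function.comp_apply, indicator_of_mem this, sub_sub_cancel]

lemma IsScalarSolution.sub_eq_integral (ha : Real.pi / 2 ≤ a) (ha' : a < Real.pi)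
    (hr : MemL2Pi r) (hr' : MemL2Pi r')
    (hrr' : ∀ᵐ x ∂(volume.restrict (Ioo 0 a)), r x = r' x)
    (hf : IsScalarSolution r z f) (hg : IsScalarSolution r' z g) (h0 : f 0 = g 0)
    (hf0 : f 0 ≠ 0) :
    f Real.pi - g Real.pi = f 0 * ∫ s in Ioo 0 (Real.pi - a), ((s : ℂ) *
      (r (Real.pi - s) - r' (Real.pi - s))) * transOp (Real.pi - a) r (expL (Real.pi - a) z) s := by
  set b := Real.pi - a with hb
  have hb0 : 0 ≤ b := by linarith
  have hbπ : b < Real.pi := by linarith [Real.pi_pos]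
  have hba : b ≤ a := by linarith
  have hrb := hr.memLp hbπ
  have hrr'b : r =ᵐ[volume.restrict (Ioo 0 b)] r' :=
    ae_restrict_of_ae_restrict_of_subset (Ioo_subset_Ioo_right hba) hrr'
  have e1 := hf.toLp_eq hbπ.le hrb
  have e2 := hg.toLp_eq hbπ.le (hr'.memLp hbπ)
  rw [← h0, ← convOp_congr hrb hrr'b] at e2
  have e3 := convOp_eq_transOp hb0 hrb e1 e2
  set c := f 0
  have e4 : ∀ᵐ s ∂(volume.restrict (Ioo 0 b)), conv Real.pi f g s =
      c ^ 2 * (s * transOp b r (expL b z) s) := by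
    have hF : (hf.memLp hbπ.le).toLp =ᵐ[volume.restrict (Ioo 0 b)] f := MemLp.coeFn_toLp _
    have hG : (hg.memLp hbπ.le).toLp =ᵐ[volume.restrict (Ioo 0 b)] g := MemLp.coeFn_toLp _
    filter_upwards [coeFn_convOp (Lp.memLp (hf.memLp hbπ.le).toLp) (hg.memLp hbπ.le).toLp,
      Lp.coeFn_smul (c ^ 2) (coordOp b (transOp b r (expL b z))),
      coeFn_coordOp (transOp b r (expL b z)), ae_restrict_mem measurableSet_Ioo]
      with s h1 h2 h3 hs
    rw [← conv_eq_conv_of_le hbπ.le (Ioo_subset_Ioc_self hs), ← conv_congr hF hG, ← h1, e3, h2,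
      Pi.smul_apply, h3, smul_eq_mul]
  have e5 : f Real.pi * c - c * g Real.pi = c ^ 2 * ∫ s in Ioo 0 b, ((s : ℂ) *
      (r (Real.pi - s) - r' (Real.pi - s))) * transOp b r (expL b z) s := by
    have hl := hf.lagrange_identity hr hr' hg
    rw [← h0] at hl
    rw [hl, ← integral_sub_left_eq_self _ volume Real.pi, ← integral_const_mul,
      ← integral_indicator measurableSet_Ioo]
    simp only [sub_sub_cancel]
    apply integral_congr_ae
    have hae1 : ∀ᵐ s : ℝ, Real.pi - s ∈ Ioo 0 a → r (Real.pi - s) = r' (Real.pi - s) :=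
      (quasiMeasurePreserving_sub_left volume Real.pi).ae
        ((ae_restrict_iff' measurableSet_Ioo).1 hrr')
    -- At s = b the argument π - s equals a, where nothing is known about r = r'.
    have hae2 : ∀ᵐ s : ℝ, s ≠ b := by simp [ae_iff]
    rw [ae_restrict_iff' measurableSet_Ioo] at e4
    filter_upwards [hae1, hae2, e4] with s h1 h2 h3
    by_cases hs : s ∈ Ioo 0 b
    · have hs' : Real.pi - s ∈ Ioo 0 Real.pi := ⟨by linarith [hs.2], by linarith [hs.1]⟩
      rw [indicator_of_mem hs', indicator_of_mem hs', indicator_of_mem hs, h3 hs]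
      ring
    · rw [indicator_of_notMem hs]
      by_cases hs' : Real.pi - s ∈ Ioo 0 Real.pi
      · have hs0 : 0 < s := by linarith [hs'.2]
        have hsb : b < s := lt_of_le_of_ne (not_lt.1 fun h => hs ⟨hs0, h⟩) h2.symm
        rw [indicator_of_mem hs', indicator_of_mem hs', h1 ⟨hs'.1, by linarith⟩]
        ring
      · rw [indicator_of_notMem hs', indicator_of_notMem hs']
        ring
  apply mul_left_cancel₀ hf0
  linear_combination e5

theorem exists_representation (ha : Real.pi / 2 ≤ a) (ha' : a < Real.pi)
    (hr : MemL2Pi r) (hr' : MemL2Pi r')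
    (hrr' : ∀ᵐ x ∂(volume.restrict (Ioo 0 a)), r x = r' x) :
    ∃ h : ℝ → ℂ, MemLp h 2 (volume.restrict (Ioo 0 (Real.pi - a))) ∧
      (∀ z f g, IsScalarSolution r z f → IsScalarSolution r' z g → f 0 = g 0 → f 0 ≠ 0 →
        f Real.pi - g Real.pi = f 0 * ∫ s in Ioo 0 (Real.pi - a), h s * expFun z s) ∧
      (h =ᵐ[volume.restrict (Ioo 0 (Real.pi - a))] 0 →
        ∀ᵐ x ∂(volume.restrict (Ioo a Real.pi)), r x = r' x) := by
  set b := Real.pi - a with hb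
  have hb0 : 0 ≤ b := by linarith
  have hbπ : b < Real.pi := by linarith [Real.pi_pos]
  set T := transOp b r
  -- The conjugation offsets the conjugate-linear first slot of the inner product, so that pairing
  -- with σ is the plain integral.
  have hσ := ((hr.sub hr').memLp_reflect hbπ.le).star
  set σ : L2 b := hσ.toLp
  have hσe : σ =ᵐ[volume.restrict (Ioo 0 b)] _ := hσ.coeFn_toLp
  set k : L2 b := ContinuousLinearMap.adjoint T σ
  refine ⟨star k, (Lp.memLp k).star, fun z f g hf hg h0 hf0 => ?_, fun hk => ?_⟩
  · rw [hf.sub_eq_integral ha ha' hr hr' hrr' hg h0 hf0]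
    congr 1
    have h1 : inner ℂ σ (T (expL b z)) = inner ℂ k (expL b z) :=
      (ContinuousLinearMap.adjoint_inner_left T _ _).symm
    rw [L2.inner_def, L2.inner_def] at h1
    calc _ = ∫ s in Ioo 0 b, inner ℂ (σ s) (T (expL b z) s) := by
          apply integral_congr_ae
          filter_upwards [hσe] with s hs
          rw [hs]
          simp only [Pi.star_apply, RCLike.inner_apply, RCLike.star_def, RingHomCompTriple.comp_apply,
            RingHom.id_apply, mul_comm]
          rfl
      _ = _ := by
          rw [h1]
          apply integral_congr_ae
          filter_upwards [coeFn_expL z] with s hs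
          rw [hs]
          simp [mul_comm]
  · have hk0 : k = 0 := by
      rw [Lp.eq_zero_iff_ae_eq_zero]
      filter_upwards [hk] with s hs
      simpa using hs
    obtain ⟨U, hU⟩ := isUnit_transOp hb0 (hr.memLp hbπ)
    have h1 : inner ℂ σ σ = (0 : ℂ) := by
      -- Since σ lies in the range of T, ⟨σ, σ⟩ = ⟨T*σ, T⁻¹σ⟩, which vanishes with k = T*σ.
      have h2 : σ = T ((U⁻¹ : (L2 b →L[ℂ] L2 b)ˣ).1 σ) := by
        change σ = (transOp b r * (U⁻¹ : (L2 b →L[ℂ] L2 b)ˣ).1) σ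
        rw [← hU, Units.mul_inv]
        rfl
      refine (congrArg (inner ℂ σ) h2).trans
        ((ContinuousLinearMap.adjoint_inner_left T _ σ).symm.trans ?_)
      change inner ℂ k _ = _
      rw [hk0, inner_zero_left]
    have h3 : σ = 0 := inner_self_eq_zero.1 h1
    apply ae_restrict_of_reflect
    rw [Lp.eq_zero_iff_ae_eq_zero] at h3
    filter_upwards [h3, hσe, ae_restrict_mem measurableSet_Ioo] with s h4 h5 hs
    rw [h4] at h5
    have hs0 : (s : ℂ) ≠ 0 := by exact_mod_cast hs.1.ne'
    have h6 : (s : ℂ) * (r (Real.pi - s) - r' (Real.pi - s)) = 0 := star_eq_zero.1 h5.symm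
    exact sub_eq_zero.1 ((mul_eq_zero.1 h6).resolve_left hs0)

end Representation

/-! ### Diagonalisation of the Dirac system. -/

section Reduction

variable {p q y₁ y₂ : ℝ → ℂ} {z ε : ℂ}

lemma MemL2Pi.diagonal (hp : MemL2Pi p) (hq : MemL2Pi q) (ε : ℂ) :
    MemL2Pi fun x => ε * (p x + ε * q x) := by
  refine (((MemLp.const_mul hp ε).add ((MemLp.const_mul hq (ε * ε))))).ae_eq
    (Filter.Eventually.of_forall fun x => ?_)
  simp only [Pi.add_apply]
  ring

lemma MemL2Pi.intervalIntegrable_mul (hp : MemL2Pi p) {y : ℝ → ℂ}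
    (hy : ContinuousOn y (Icc 0 Real.pi)) {x : ℝ} (hx : x ∈ Ioo 0 Real.pi) :
    IntervalIntegrable (fun t => p (x - t) * y t) volume 0 x := by
  have h1 : IntervalIntegrable p volume 0 x :=
    (intervalIntegrable_iff_integrableOn_Ioo_of_le hx.1.le).2
      (memLp_one_iff_integrable.1 ((hp.memLp hx.2).mono_exponent (by norm_num)))
  have h2 := (h1.comp_sub_left x).symm
  simp only [sub_zero, sub_self] at h2
  refine h2.mul_continuousOn (hy.mono ?_)
  rw [uIcc_of_le hx.1.le]
  exact Icc_subset_Icc_right hx.2.le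

/-- The row vector (1, -ε) is a left eigenvector of B with eigenvalue ε, hence of M = p + qB with
eigenvalue p + εq. The factor 1/2 makes the functions for ε and -ε add up to y₁. -/
lemma IsSolution.isScalarSolution (h : IsSolution p q z y₁ y₂) (hp : MemL2Pi p)
    (hq : MemL2Pi q) (hε : ε ^ 2 = -1) :
    IsScalarSolution (fun x => ε * (p x + ε * q x)) (-ε * z)
      (fun x => (2⁻¹ : ℂ) * (y₁ x - ε * y₂ x)) := by
  have hc₁ := h.ac₁.continuousOn
  have hc₂ := h.ac₂.continuousOn
  rw [uIcc_of_le Real.pi_pos.le] at hc₁ hc₂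
  refine ⟨(h.ac₁.fun_sub (h.ac₂.const_smul ε)).const_smul (2⁻¹ : ℂ), ?_⟩
  filter_upwards [h.eq₁, h.eq₂, ae_restrict_mem measurableSet_Ioo] with x h1 h2 hx
  have h3 := (h2.sub (h1.const_mul ε)).const_mul (2⁻¹ : ℂ)
  convert! h3 using 1
  have i1 := hp.intervalIntegrable_mul hc₁ hx
  have i2 := hp.intervalIntegrable_mul hc₂ hx
  have i3 := hq.intervalIntegrable_mul hc₁ hx
  have i4 := hq.intervalIntegrable_mul hc₂ hx
  have e1 : ∫ t in (0 : ℝ)..x, (p (x - t) * y₁ t + q (x - t) * y₂ t) =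
      (∫ t in (0 : ℝ)..x, p (x - t) * y₁ t) + ∫ t in (0 : ℝ)..x, q (x - t) * y₂ t :=
    intervalIntegral.integral_add i1 i4
  have e2 : ∫ t in (0 : ℝ)..x, (-q (x - t) * y₁ t + p (x - t) * y₂ t) =
      -(∫ t in (0 : ℝ)..x, q (x - t) * y₁ t) + ∫ t in (0 : ℝ)..x, p (x - t) * y₂ t := by
    rw [← intervalIntegral.integral_neg]
    simp only [neg_mul]
    exact intervalIntegral.integral_add i3.neg i2
  have e3 : conv Real.pi (fun x => ε * (p x + ε * q x))
      (fun x => (2⁻¹ : ℂ) * (y₁ x - ε * y₂ x)) x =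
      2⁻¹ * (ε * (∫ t in (0 : ℝ)..x, p (x - t) * y₁ t) +
        (∫ t in (0 : ℝ)..x, p (x - t) * y₂ t) - (∫ t in (0 : ℝ)..x, q (x - t) * y₁ t) +
        ε * ∫ t in (0 : ℝ)..x, q (x - t) * y₂ t) := by
    rw [conv_eq_intervalIntegral (Ioo_subset_Ioc_self hx), ← intervalIntegral.integral_const_mul,
      ← intervalIntegral.integral_const_mul, ← intervalIntegral.integral_add (i1.const_mul ε) i2,
      ← intervalIntegral.integral_sub ((i1.const_mul ε).add i2) i3,
      ← intervalIntegral.integral_add (((i1.const_mul ε).add i2).sub i3) (i4.const_mul ε),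
      ← intervalIntegral.integral_const_mul]
    congr 1
    ext t
    linear_combination (2⁻¹ * (q (x - t) * y₁ t - p (x - t) * y₂ t -
      ε * q (x - t) * y₂ t)) * hε
  rw [e1, e2, e3]
  linear_combination (2⁻¹ * z * y₂ x) * hε

end Reduction

/-! ### Derivatives of sine-cosine transforms in the spectral parameter. -/

section TrigonometricTransform

variable {b : ℝ} {w₁ w₂ : ℝ → ℂ}

lemma exists_bound_sin_cos (b : ℝ) (z : ℂ) : ∃ C : ℝ, ∀ x ∈ Metric.ball z 1, ∀ t ∈ Ioo 0 b,
    ‖Complex.sin (x * t)‖ ≤ C ∧ ‖Complex.cos (x * t)‖ ≤ C := by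
  have hK : IsCompact (Metric.closedBall z 1 ×ˢ Icc 0 b) :=
    (isCompact_closedBall z 1).prod isCompact_Icc
  obtain ⟨C, hC⟩ := hK.exists_bound_of_continuousOn
    (f := fun w : ℂ × ℝ => Complex.sin (w.1 * w.2)) (by fun_prop)
  obtain ⟨D, hD⟩ := hK.exists_bound_of_continuousOn
    (f := fun w : ℂ × ℝ => Complex.cos (w.1 * w.2)) (by fun_prop)
  refine ⟨max C D, fun x hx t ht => ?_⟩
  have hm : (x, t) ∈ Metric.closedBall z 1 ×ˢ Icc 0 b :=
    ⟨Metric.ball_subset_closedBall hx, Ioo_subset_Icc_self ht⟩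
  exact ⟨(hC _ hm).trans (le_max_left _ _), (hD _ hm).trans (le_max_right _ _)⟩

lemma hasDerivAt_sin_mul (t z : ℂ) :
    HasDerivAt (fun x => Complex.sin (x * t)) (t * Complex.cos (z * t)) z := by
  have := (hasDerivAt_mul_const (x := z) t).csin
  rwa [mul_comm] at this

lemma hasDerivAt_cos_mul (t z : ℂ) :
    HasDerivAt (fun x => Complex.cos (x * t)) (-t * Complex.sin (z * t)) z := by
  have := (hasDerivAt_mul_const (x := z) t).ccos
  convert! this using 1
  ring

lemma integrableOn_mul_continuous {w m : ℝ → ℂ} (hw : IntegrableOn w (Ioo 0 b))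
    (hm : Continuous m) : IntegrableOn (fun t => m t * w t) (Ioo 0 b) := by
  obtain ⟨C, hC⟩ := isCompact_Icc.exists_bound_of_continuousOn (s := Icc 0 b) hm.continuousOn
  refine Integrable.bdd_mul (c := C) hw hm.aestronglyMeasurable ?_
  filter_upwards [ae_restrict_mem measurableSet_Ioo] with t ht
  exact hC t (Ioo_subset_Icc_self ht)

/-- The derivative is again such a transform, with (w₁, w₂) replaced by (-tw₂, tw₁); this drives the
induction for higher derivatives. -/
lemma hasDerivAt_trigTransform (h₁ : IntegrableOn w₁ (Ioo 0 b)) (h₂ : IntegrableOn w₂ (Ioo 0 b))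
    (z : ℂ) : HasDerivAt
      (fun x : ℂ => ∫ t in Ioo 0 b, (w₁ t * Complex.sin (x * t) + w₂ t * Complex.cos (x * t)))
      (∫ t in Ioo 0 b, ((-(t : ℂ) * w₂ t) * Complex.sin (z * t) +
        ((t : ℂ) * w₁ t) * Complex.cos (z * t))) z := by
  have hint : ∀ {v₁ v₂ : ℝ → ℂ}, IntegrableOn v₁ (Ioo 0 b) → IntegrableOn v₂ (Ioo 0 b) →
      ∀ x : ℂ, IntegrableOn (fun t : ℝ => v₁ t * Complex.sin (x * t) + v₂ t * Complex.cos (x * t))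
        (Ioo 0 b) := fun hv₁ hv₂ x => by
    have e1 := integrableOn_mul_continuous hv₁ (m := fun t : ℝ => Complex.sin (x * t)) (by fun_prop)
    have e2 := integrableOn_mul_continuous hv₂ (m := fun t : ℝ => Complex.cos (x * t)) (by fun_prop)
    refine (e1.add e2).congr (Filter.Eventually.of_forall fun t => ?_)
    simp only [Pi.add_apply]
    ring
  have ht₁ : IntegrableOn (fun t : ℝ => (t : ℂ) * w₁ t) (Ioo 0 b) :=
    integrableOn_mul_continuous h₁ (by fun_prop)
  have ht₂ : IntegrableOn (fun t : ℝ => -(t : ℂ) * w₂ t) (Ioo 0 b) :=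
    integrableOn_mul_continuous h₂ (by fun_prop)
  obtain ⟨C, hC⟩ := exists_bound_sin_cos b z
  refine (hasDerivAt_integral_of_dominated_loc_of_deriv_le (𝕜 := ℂ) (μ := volume.restrict (Ioo 0 b))
    (F := fun x t => w₁ t * Complex.sin (x * t) + w₂ t * Complex.cos (x * t))
    (F' := fun x t => (-(t : ℂ) * w₂ t) *
      Complex.sin (x * t) + ((t : ℂ) * w₁ t) * Complex.cos (x * t))
    (bound := fun t => ‖-(t : ℂ) * w₂ t‖ * C + ‖(t : ℂ) * w₁ t‖ * C)
    (Metric.ball_mem_nhds z one_pos)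
    (Filter.Eventually.of_forall fun x => (hint h₁ h₂ x).aestronglyMeasurable) (hint h₁ h₂ z)
    (hint ht₂ ht₁ z).aestronglyMeasurable ?_
    ((ht₂.norm.mul_const C).add (ht₁.norm.mul_const C)) ?_).2
  · filter_upwards [ae_restrict_mem measurableSet_Ioo] with t ht x hx
    refine (norm_add_le _ _).trans ?_
    rw [norm_mul _ (Complex.sin _), norm_mul _ (Complex.cos _)]
    gcongr
    · exact (hC x hx t ht).1
    · exact (hC x hx t ht).2
  · refine Filter.Eventually.of_forall fun t x _ => ?_
    convert! ((hasDerivAt_sin_mul t x).const_mul (w₁ t)).add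
      ((hasDerivAt_cos_mul t x).const_mul (w₂ t)) using 1
    ring

lemma iteratedDeriv_trigTransform (n : ℕ) (h₁ : IntegrableOn w₁ (Ioo 0 b))
    (h₂ : IntegrableOn w₂ (Ioo 0 b)) (z : ℂ) :
    iteratedDeriv n (fun x : ℂ => ∫ t in Ioo 0 b,
        (w₁ t * Complex.sin (x * t) + w₂ t * Complex.cos (x * t))) z =
      ∫ t in Ioo 0 b, (w₁ t * iteratedDeriv n (fun x : ℂ => Complex.sin (x * t)) z +
        w₂ t * iteratedDeriv n (fun x : ℂ => Complex.cos (x * t)) z) := by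
  induction n generalizing w₁ w₂ with
  | zero => simp
  | succ n ih =>
    rw [iteratedDeriv_succ', funext fun x => (hasDerivAt_trigTransform h₁ h₂ x).deriv,
      ih (integrableOn_mul_continuous h₂ (by fun_prop))
        (integrableOn_mul_continuous h₁ (by fun_prop))]
    congr 1
    ext t
    rw [iteratedDeriv_succ', iteratedDeriv_succ',
      funext fun x => (hasDerivAt_sin_mul t x).deriv,
      funext fun x => (hasDerivAt_cos_mul t x).deriv, iteratedDeriv_const_mul_field,
      iteratedDeriv_const_mul_field]
    ring

end TrigonometricTransform

/-! ### Completeness and orders of zeros. -/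

section Completeness

variable {b : ℝ}

lemma eq_zero_of_isCompleteSystem {S : Set (HilbertPair b)} (hS : IsCompleteSystem S)
    {k : HilbertPair b} (hk : ∀ f ∈ S, inner ℂ k f = 0) : k = 0 := by
  have h1 : (Submodule.span ℂ S)ᗮ = ⊥ := Submodule.topologicalClosure_eq_top_iff.1 hS
  have h2 : k ∈ (Submodule.span ℂ S)ᗮ := by
    rw [Submodule.mem_orthogonal']
    intro u hu
    induction hu using Submodule.span_induction with
    | mem f hf => exact hk f hf
    | zero => exact inner_zero_right _
    | add f g _ _ hf hg => rw [inner_add_right, hf, hg, add_zero]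
    | smul c f _ hf => rw [inner_smul_right, hf, mul_zero]
  rwa [h1, Submodule.mem_bot] at h2

lemma inner_toLp_star {w : ℝ → ℂ} (hw : MemLp w 2 (volume.restrict (Ioo 0 b))) (f : L2 b) :
    inner ℂ hw.star.toLp f = ∫ t in Ioo 0 b, w t * f t := by
  rw [L2.inner_def]
  apply integral_congr_ae
  filter_upwards [hw.star.coeFn_toLp] with t ht
  rw [ht]
  simp [mul_comm]

/-- Differentiating under the integral, each vanishing derivative says that the conjugated pair (w₁,
w₂) is orthogonal to one member of the system. -/
lemma ae_eq_zero_of_isCompleteSystem {w₁ w₂ : ℝ → ℂ} {lam : ℤ → ℂ} {I : Set ℤ}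
    (hS : IsCompleteSystem (systemS b lam I))
    (h₁ : MemLp w₁ 2 (volume.restrict (Ioo 0 b))) (h₂ : MemLp w₂ 2 (volume.restrict (Ioo 0 b)))
    (h : ∀ k ∈ I, ∀ j : ℕ, (j : ℕ∞) < multIn lam I k →
      iteratedDeriv j (fun x : ℂ => ∫ t in Ioo 0 b,
        (w₁ t * Complex.sin (x * t) + w₂ t * Complex.cos (x * t))) (lam k) = 0) :
    w₁ =ᵐ[volume.restrict (Ioo 0 b)] 0 ∧ w₂ =ᵐ[volume.restrict (Ioo 0 b)] 0 := by
  have hint : ∀ {w : ℝ → ℂ}, MemLp w 2 (volume.restrict (Ioo 0 b)) → IntegrableOn w (Ioo 0 b) :=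
    fun hw => memLp_one_iff_integrable.1 (hw.mono_exponent (by norm_num))
  have h0 : (WithLp.toLp 2 (h₁.star.toLp, h₂.star.toLp) : HilbertPair b) = 0 := by
    refine eq_zero_of_isCompleteSystem hS fun f hf => ?_
    obtain ⟨k, hk, j, hj, hf₁, hf₂⟩ := hf
    have h3 := h k hk j hj
    rw [iteratedDeriv_trigTransform j (hint h₁) (hint h₂)] at h3
    rw [WithLp.prod_inner_apply]
    change inner ℂ h₁.star.toLp f.fst + inner ℂ h₂.star.toLp f.snd = 0
    rw [inner_toLp_star h₁, inner_toLp_star h₂, ← h3]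
    refine (integral_add (h₁.integrable_mul (Lp.memLp f.fst))
      (h₂.integrable_mul (Lp.memLp f.snd))).symm.trans ?_
    apply integral_congr_ae
    filter_upwards [hf₁, hf₂] with t e1 e2
    simp only [Pi.mul_apply]
    rw [e1, e2]
  have hz : ∀ {w : ℝ → ℂ} (hw : MemLp w 2 (volume.restrict (Ioo 0 b))), hw.star.toLp = 0 →
      w =ᵐ[volume.restrict (Ioo 0 b)] 0 := fun hw hw0 => by
    rw [Lp.eq_zero_iff_ae_eq_zero] at hw0
    filter_upwards [hw0, hw.star.coeFn_toLp] with t e1 e2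
    rw [e1] at e2
    exact star_eq_zero.1 e2.symm
  exact ⟨hz h₁ (congrArg WithLp.fst h0), hz h₂ (congrArg WithLp.snd h0)⟩

lemma iteratedDeriv_sub_eq_zero {Δ Δ' : ℂ → ℂ} {z : ℂ} {j : ℕ}
    (h : (j : ℕ∞) < analyticOrderAt Δ z) (h' : (j : ℕ∞) < analyticOrderAt Δ' z) :
    iteratedDeriv j (Δ - Δ') z = 0 := by
  -- `analyticOrderAt` is 0 at a point of non-analyticity, so an order exceeding j already implies
  -- analyticity.
  have ha : ∀ {f : ℂ → ℂ}, (j : ℕ∞) < analyticOrderAt f z → AnalyticAt ℂ f z := fun hf => by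
    by_contra hn
    rw [analyticOrderAt_of_not_analyticAt hn] at hf
    exact not_lt_zero hf
  have h1 : ((j + 1 : ℕ) : ℕ∞) ≤ analyticOrderAt (Δ - Δ') z := by
    refine (le_min ?_ ?_).trans le_analyticOrderAt_sub
    · exact_mod_cast Order.add_one_le_of_lt h
    · exact_mod_cast Order.add_one_le_of_lt h'
  exact (natCast_le_analyticOrderAt_iff_iteratedDeriv_eq_zero ((ha h).sub (ha h'))).1 h1 j
    j.lt_succ_self

end Completeness

end IntegroDirac

end

/-! ### The uniqueness theorem. -/

theorem theorem2 (a : ℝ) (ha : Real.pi / 2 ≤ a) (ha' : a < Real.pi)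
    (p q p' q' : ℝ → ℂ)
    (hp : IntegroDirac.MemL2Pi p) (hq : IntegroDirac.MemL2Pi q)
    (hp' : IntegroDirac.MemL2Pi p') (hq' : IntegroDirac.MemL2Pi q')
    (hpp' : ∀ᵐ x ∂(volume.restrict (Ioo 0 a)), p x = p' x)
    (hqq' : ∀ᵐ x ∂(volume.restrict (Ioo 0 a)), q x = q' x)
    (lam lam' : ℤ → ℂ)
    (hlam : IntegroDirac.IsEigenvalueNumbering p q lam)
    (hlam' : IntegroDirac.IsEigenvalueNumbering p' q' lam')
    (hasymp : IntegroDirac.HasAsymptotics lam)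
    (hasymp' : IntegroDirac.HasAsymptotics lam')
    (I : Set ℤ) (hI : ∀ k ∈ I, lam k = lam' k)
    (hS : IntegroDirac.IsCompleteSystem (IntegroDirac.systemS (Real.pi - a) lam I)) :
    (∀ᵐ x ∂(volume.restrict (Ioo a Real.pi)), p x = p' x) ∧
      (∀ᵐ x ∂(volume.restrict (Ioo a Real.pi)), q x = q' x) := by
  open IntegroDirac in
  obtain ⟨Δ, hΔ, hmult⟩ := hlam.multiplicity
  obtain ⟨Δ', hΔ', hmult'⟩ := hlam'.multiplicity
  have hrep := fun ε : ℂ => exists_representation ha ha' (hp.diagonal hq ε)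
    (hp'.diagonal hq' ε) (by
      filter_upwards [hpp', hqq'] with x h1 h2
      rw [h1, h2])
  obtain ⟨h₁, hm₁, hrep₁, hz₁⟩ := hrep Complex.I
  obtain ⟨h₂, hm₂, hrep₂, hz₂⟩ := hrep (-Complex.I)
  set b := Real.pi - a
  -- These are the coefficients of sin zt and cos zt in (i/2)(h₁ exp(-izt) - h₂ exp(izt)), the
  -- integrand of Δ - Δ̃.
  set w₁ : ℝ → ℂ := fun t => 2⁻¹ * (h₁ t + h₂ t) with hw₁
  set w₂ : ℝ → ℂ := fun t => Complex.I / 2 * (h₁ t - h₂ t) with hw₂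
  have hmw₁ : MemLp w₁ 2 (volume.restrict (Ioo 0 b)) := (hm₁.add hm₂).const_mul _
  have hmw₂ : MemLp w₂ 2 (volume.restrict (Ioo 0 b)) := (hm₁.sub hm₂).const_mul _
  have hdiff : Δ - Δ' = fun z : ℂ => ∫ t in Ioo 0 b,
      (w₁ t * Complex.sin (z * t) + w₂ t * Complex.cos (z * t)) := by
    ext z
    obtain ⟨S₁, S₂, hs, hs1, hs2, hsΔ⟩ := hΔ z
    obtain ⟨S₁', S₂', hs', hs1', hs2', hsΔ'⟩ := hΔ' z
    have key : ∀ {ε : ℂ} {h : ℝ → ℂ}, ε ^ 2 = -1 →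
        (∀ z f g, IsScalarSolution (fun x => ε * (p x + ε * q x)) z f →
          IsScalarSolution (fun x => ε * (p' x + ε * q' x)) z g → f 0 = g 0 → f 0 ≠ 0 →
          f Real.pi - g Real.pi = f 0 * ∫ s in Ioo 0 b, h s * expFun z s) →
        2⁻¹ * (S₁ Real.pi - ε * S₂ Real.pi) - 2⁻¹ * (S₁' Real.pi - ε * S₂' Real.pi) =
          2⁻¹ * ε * ∫ s in Ioo 0 b, h s * expFun (-ε * z) s := by
      intro ε h hε hr
      have hε0 : ε ≠ 0 := fun h0 => by simp [h0] at hε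
      -- The initial data (0, -1) give both scalar solutions the value ε/2 ≠ 0 at 0.
      have := hr (-ε * z) _ _ (hs.isScalarSolution hp hq hε) (hs'.isScalarSolution hp' hq' hε)
        (by simp only [hs1, hs2, hs1', hs2']) (by simp [hs1, hs2, hε0])
      rw [this, hs1, hs2]
      ring
    have k1 := key Complex.I_sq hrep₁
    have k2 := key (ε := -Complex.I) (by rw [neg_sq, Complex.I_sq]) hrep₂
    have hsum : Δ z - Δ' z = 2⁻¹ * Complex.I * (∫ s in Ioo 0 b, h₁ s * expFun (-Complex.I * z) s) +
        2⁻¹ * (-Complex.I) * ∫ s in Ioo 0 b, h₂ s * expFun (-(-Complex.I) * z) s := by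
      rw [← k1, ← k2, hsΔ, hsΔ']
      ring
    rw [Pi.sub_apply, hsum, ← integral_const_mul, ← integral_const_mul, ← integral_add]
    · congr 1
      ext t
      have e1 : expFun (-Complex.I * z) t =
          Complex.cos (z * t) - Complex.sin (z * t) * Complex.I := by
        rw [expFun, show -Complex.I * z * t = -(z * t) * Complex.I by ring, Complex.exp_mul_I,
          Complex.cos_neg, Complex.sin_neg]
        ring
      have e2 : expFun (-(-Complex.I) * z) t =
          Complex.cos (z * t) + Complex.sin (z * t) * Complex.I := by
        rw [expFun, show -(-Complex.I) * z * t = (z * t) * Complex.I by ring, Complex.exp_mul_I]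
      rw [e1, e2, hw₁, hw₂]
      linear_combination (-2⁻¹ * (h₁ t + h₂ t) * Complex.sin (z * t)) * Complex.I_sq
    · exact (hm₁.integrable_mul (memLp_expFun _ 2)).const_mul _
    · exact (hm₂.integrable_mul (memLp_expFun _ 2)).const_mul _
  have hvan := ae_eq_zero_of_isCompleteSystem hS hmw₁ hmw₂ fun k hk j hj => by
    rw [← hdiff]
    apply iteratedDeriv_sub_eq_zero
    · rw [← hmult]
      exact hj.trans_le (encard_le_encard fun i hi => hi.2)
    · rw [← hmult']
      refine hj.trans_le (encard_le_encard fun i hi => ?_)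
      -- Indices in I sharing the value of `lam` also share that of `lam'`, so the same count bounds
      -- the order of Δ̃ from below.
      rw [mem_ofPred_eq, ← hI i hi.1]
      exact hi.2
  have hzero₁ : h₁ =ᵐ[volume.restrict (Ioo 0 b)] 0 := by
    filter_upwards [hvan.1, hvan.2] with t e1 e2
    simp only [hw₁, hw₂, Pi.zero_apply] at e1 e2 ⊢
    linear_combination e1 - Complex.I * e2 + (2⁻¹ * (h₁ t - h₂ t)) * Complex.I_sq
  have hzero₂ : h₂ =ᵐ[volume.restrict (Ioo 0 b)] 0 := by
    filter_upwards [hvan.1, hvan.2] with t e1 e2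
    simp only [hw₁, hw₂, Pi.zero_apply] at e1 e2 ⊢
    linear_combination e1 + Complex.I * e2 - (2⁻¹ * (h₁ t - h₂ t)) * Complex.I_sq
  constructor
  -- The potentials are ±ip - q, so their difference recovers p and their sum recovers q.
  · filter_upwards [hz₁ hzero₁, hz₂ hzero₂] with x e1 e2
    linear_combination (-Complex.I / 2) * e1 + (Complex.I / 2) * e2 + (p x - p' x) * Complex.I_sq
  · filter_upwards [hz₁ hzero₁, hz₂ hzero₂] with x e1 e2
    linear_combination (-2⁻¹ : ℂ) * e1 - (2⁻¹ : ℂ) * e2 + (q x - q' x) * Complex.I_sq
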